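/- A planar drawing of a graph maps the vertices to distinct points of the Euclidean plane and the edges to simple arcs between their endvertices, so that no edge passes through another vertex and two distinct edges meet at most in a common endvertex. A planar drawing is *bendless smooth orthogonal* if every edge is a single horizontal or vertical segment or a single quarter, half or three-quarter circular arc whose tangents at its two endpoints are axis-aligned, and no two edges leave a vertex in the same direction (through the same port). It is *bendless octilinear* if every edge is a single straight-line segment that is horizontal, vertical or diagonal (of slope $\pm 1$). **Theorem.** There is an infinite family of finite connected $4$-regular planar graphs that admit bendless smooth orthogonal drawings but no bendless octilinear drawings. More precisely, there are a finite biconnected planar graph $C$, with one vertex of degree $2$ and all other vertices of degree $4$, and pairwise non-isomorphic finite connected $4$-regular planar graphs $G_0, G_1, G_2, \ldots$ such that $C$ and all the graphs $G_k$ admit bendless smooth orthogonal drawings but no bendless octilinear drawings, and each $G_k$ consists of $k+2$ biconnected components $C_1,\ldots,C_{k+2}$ arranged in a chain (consecutive components share exactly one vertex, non-consecutive ones are disjoint), where $C_1$ and $C_{k+2}$ are isomorphic to $C$. -/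

import Mathlib

section

open Complex

/-- `S` is a simple (Jordan) arc in the plane with endpoints `p` and `q`. -/
def IsSimpleArc (p q : ℂ) (S : Set ℂ) : Prop :=
  ∃ γ : Path p q, Function.Injective γ ∧ Set.range γ = S

/-- A planar (crossing-free) drawing of a graph in the Euclidean plane `ℂ`: vertices are distinct
points, every edge is a simple arc joining its endvertices and avoiding all other vertices, and
two distinct edges meet at most in a common endvertex. (The values of `edge` at unordered pairs
that are not edges are irrelevant.) -/
structure PlanarDrawing {V : Type*} (G : SimpleGraph V) where
  pos : V → ℂ
  edge : Sym2 V → Set ℂ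
  pos_injective : Function.Injective pos
  edge_isSimpleArc : ∀ u v, G.Adj u v → IsSimpleArc (pos u) (pos v) (edge s(u, v))
  eq_or_eq_of_pos_mem : ∀ u v w, G.Adj u v → pos w ∈ edge s(u, v) → w = u ∨ w = v
  edge_inter : ∀ e ∈ G.edgeSet, ∀ f ∈ G.edgeSet, e ≠ f → ∀ z ∈ edge e ∩ edge f,
    ∃ w, w ∈ e ∧ w ∈ f ∧ z = pos w

/-- A graph is planar if it has a planar drawing. -/
def IsPlanarGraph {V : Type*} (G : SimpleGraph V) : Prop :=
  Nonempty (PlanarDrawing G)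

/-- `S` is a horizontal or vertical line segment of positive length from `p` to `q`. The unit
vectors `a` and `b` are the ports it uses, i.e. the directions in which it leaves `p` and `q`. -/
def IsAxisParallelSegment (p q : ℂ) (S : Set ℂ) (a b : ℂ) : Prop :=
  ∃ (k : ℕ) (l : ℝ), 0 < l ∧ q = p + l * I ^ k ∧ S = segment ℝ p q ∧ a = I ^ k ∧ b = -I ^ k

/-- `S` is a quarter, half or three-quarter circular arc (`m = 1, 2, 3`) from `p` to `q` with
axis-aligned tangents at its endpoints. The arc lies on the circle with center `z` and radius `r`,
starts at the extreme point `p = z + r * I ^ k` and runs counterclockwise (`σ = 1`) or clockwise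
(`σ = -1`). The unit vectors `a` and `b` are the ports it uses, i.e. the directions in which
it leaves `p` and `q`; note that `(σ * I) ^ m = exp (σ * (m * π / 2) * I)`. -/
def IsAxisTangentArc (p q : ℂ) (S : Set ℂ) (a b : ℂ) : Prop :=
  ∃ (z : ℂ) (r σ : ℝ) (k m : ℕ), 0 < r ∧ (σ = 1 ∨ σ = -1) ∧ (m = 1 ∨ m = 2 ∨ m = 3) ∧
    p = z + r * I ^ k ∧
    q = z + r * I ^ k * (σ * I) ^ m ∧
    S = (fun t : ℝ => z + r * I ^ k * exp (σ * t * I)) '' Set.Icc 0 (m * Real.pi / 2) ∧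
    a = σ * I * I ^ k ∧
    b = -(σ * I * I ^ k * (σ * I) ^ m)

/-- The drawing is bendless smooth orthogonal: every edge is a single axis-parallel segment or a
single circular arc with axis-aligned tangents, and no two edges use the same port at a vertex.
Here `port u v` is the port of the edge `uv` at `u`. -/
def PlanarDrawing.IsBendlessSmoothOrthogonal {V : Type*} {G : SimpleGraph V}
    (D : PlanarDrawing G) : Prop :=
  ∃ port : V → V → ℂ,
    (∀ u v, G.Adj u v →
      IsAxisParallelSegment (D.pos u) (D.pos v) (D.edge s(u, v)) (port u v) (port v u) ∨
      IsAxisTangentArc (D.pos u) (D.pos v) (D.edge s(u, v)) (port u v) (port v u)) ∧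
    (∀ u v w, G.Adj u v → G.Adj u w → port u v = port u w → v = w)

/-- The drawing is bendless octilinear: every edge is a single line segment that is horizontal,
vertical or diagonal (of slope `1` or `-1`). By planarity, two edges never share a port. -/
def PlanarDrawing.IsBendlessOctilinear {V : Type*} {G : SimpleGraph V}
    (D : PlanarDrawing G) : Prop :=
  ∀ u v, G.Adj u v →
    D.edge s(u, v) = segment ℝ (D.pos u) (D.pos v) ∧
    ((D.pos u).im = (D.pos v).im ∨ (D.pos u).re = (D.pos v).re ∨
      |(D.pos u).re - (D.pos v).re| = |(D.pos u).im - (D.pos v).im|)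

/-- The graph admits a (planar) bendless smooth orthogonal drawing. -/
def AdmitsBendlessSmoothOrthogonal {V : Type*} (G : SimpleGraph V) : Prop :=
  ∃ D : PlanarDrawing G, D.IsBendlessSmoothOrthogonal

/-- The graph admits a (planar) bendless octilinear drawing. -/
def AdmitsBendlessOctilinear {V : Type*} (G : SimpleGraph V) : Prop :=
  ∃ D : PlanarDrawing G, D.IsBendlessOctilinear

/-- Every vertex has exactly four neighbors. -/
def IsFourRegular {V : Type*} (G : SimpleGraph V) : Prop :=
  ∀ v, (G.neighborSet v).ncard = 4

/-- A graph is biconnected if it is connected, has at least three vertices, and stays connected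
after the deletion of any single vertex. -/
def IsBiconnected {V : Type*} (G : SimpleGraph V) : Prop :=
  G.Connected ∧ 3 ≤ ENat.card V ∧ ∀ v, (G.induce {v}ᶜ).Connected

/-- The vertex sets `B 0, …, B (m - 1)` show that `G` consists of `m` biconnected components
arranged in a chain: they induce biconnected subgraphs that cover all vertices and edges of `G`,
consecutive ones share exactly one vertex, and non-consecutive ones share none. -/
structure IsChainOfBlocks {V : Type*} (G : SimpleGraph V) {m : ℕ} (B : Fin m → Set V) : Prop where
  biconnected : ∀ i, IsBiconnected (G.induce (B i))
  cover_vertex : ∀ v, ∃ i, v ∈ B i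
  cover_edge : ∀ u v, G.Adj u v → ∃ i, u ∈ B i ∧ v ∈ B i
  consecutive : ∀ i j : Fin m, (i : ℕ) + 1 = j → ∃ x, B i ∩ B j = {x}
  nonconsecutive : ∀ i j : Fin m, (i : ℕ) + 1 < j → Disjoint (B i) (B j)

/-- `C` is a finite biconnected planar graph with one vertex of degree two, all of whose other
vertices have degree four. -/
structure IsEndGadget {W : Type*} (C : SimpleGraph W) : Prop where
  finite : Finite W
  biconnected : IsBiconnected C
  planar : IsPlanarGraph C
  degree : ∃ c, (C.neighborSet c).ncard = 2 ∧ ∀ w, w ≠ c → (C.neighborSet w).ncard = 4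

end

/-! The obstruction is local. In a bendless octilinear drawing no vertex lies on an edge not
incident to it, so a triangle of the graph is drawn nondegenerately; its angles are multiples of
45°, so it is right isosceles, and once one side is placed the opposite vertex has only six possible
positions (`exists_apexRatio`). In an octahedron with antipodal pairs {0,4}, {1,5}, {2,3} and the
edge 01 removed, the triangles 452, 453, 431 and 530 reach all vertices from the edge 45. Up to
similarity this leaves 6^4 placements, and a finite check rejects each one. Hence no graph
containing this octahedron minus an edge has a bendless octilinear drawing
(`not_admitsBendlessOctilinear_of_punctured`).

The gadget C consists of that octahedron minus an edge and a second octahedron in which one vertex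
has lost two of its edges; two new edges join the four vertices that lack one edge each, and the
vertex that lost two edges keeps degree 2. An inner block joins two octahedra of the second kind in
the same way, so it has two vertices of degree 2. Gluing blocks at vertices of degree 2 gives
4-regular chains. Each block has a Hamiltonian cycle and is therefore biconnected, and the number of
vertices distinguishes the chains.

For the smooth drawings, the blocks receive Gaussian integer coordinates. Arcs are cut into
quarters, each lying in the triangle of its endpoints and the meeting point of its end tangents;
integral linear functionals, or disjointness of the carrying circles, certify that edges do not
cross. Each block touches the vertical line through its linking vertex only there, and the two
blocks meeting at that vertex use complementary ports, so translated blocks fit together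
(`chain_admitsBendlessSmoothOrthogonal`). -/

section

open Complex

/-! ### Octilinear triangles. -/

/-- `z` is horizontal, vertical or diagonal. -/
def IsOctilinear (z : ℂ) : Prop := (z ^ 4).im = 0

theorem pow_four_im (z : ℂ) :
    (z ^ 4).im = 4 * (z.re * (z.im * ((z.re - z.im) * (z.re + z.im)))) := by
  simp only [pow_succ, pow_zero, one_mul, mul_im, mul_re]; ring

/-- The imaginary part of the fourth power is, up to a factor, the product of the four linear forms
vanishing on the octilinear directions. The power form makes the condition stable under quotients,
hence under normalizing a side. -/
theorem isOctilinear_iff (z : ℂ) :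
    IsOctilinear z ↔ z.im = 0 ∨ z.re = 0 ∨ |z.re| = |z.im| := by
  rw [IsOctilinear, pow_four_im, abs_eq_abs, ← sub_eq_zero (a := z.re) (b := z.im),
    ← sub_eq_zero (a := z.re) (b := -z.im), sub_neg_eq_add]
  simp only [mul_eq_zero, OfNat.ofNat_ne_zero, false_or]
  tauto

theorem IsOctilinear.div {z w : ℂ} (hz : IsOctilinear z) (hw : IsOctilinear w) :
    IsOctilinear (z / w) := by
  unfold IsOctilinear at *
  rw [div_pow, div_im, hz, hw]; simp

theorem IsOctilinear.neg {z : ℂ} (hz : IsOctilinear z) : IsOctilinear (-z) := by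
  unfold IsOctilinear at *
  rwa [Even.neg_pow (by decide)]

/-- The ratios `t` for which `0`, `4`, `t` is a right isosceles triangle. -/
def apexRatios : List GaussianInt := [⟨0, 4⟩, ⟨0, -4⟩, ⟨4, 4⟩, ⟨4, -4⟩, ⟨2, 2⟩, ⟨2, -2⟩]

theorem mem_segment_of_ratio {p q x : ℂ} {s : ℝ} (h : x = p + (q - p) * s) (h0 : 0 ≤ s)
    (h1 : s ≤ 1) : x ∈ segment ℝ p q :=
  ⟨1 - s, s, by linarith, h0, by ring, by
    simp only [real_smul]; rw [h]; push_cast; ring⟩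

theorem exists_apexRatio {p q x : ℂ} (hpq : p ≠ q)
    (h1 : IsOctilinear (q - p)) (h2 : IsOctilinear (x - p)) (h3 : IsOctilinear (x - q))
    (n1 : x ∉ segment ℝ p q) (n2 : p ∉ segment ℝ x q) (n3 : q ∉ segment ℝ x p) :
    ∃ t ∈ apexRatios, x = p + (q - p) * (t : ℂ) / 4 := by
  have hd : q - p ≠ 0 := sub_ne_zero.2 hpq.symm
  obtain ⟨t, ht⟩ : ∃ t, t = (x - p) / (q - p) := ⟨_, rfl⟩
  have hx : x = p + (q - p) * t := by rw [ht]; field_simp; ring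
  have o2 : IsOctilinear t := ht ▸ h2.div h1
  have o3 : IsOctilinear (t - 1) := by
    have : t - 1 = (x - q) / (q - p) := by rw [ht]; field_simp; ring
    exact this ▸ h3.div h1
  -- A real ratio makes the three points collinear, so one lies between the other two; which one
  -- depends on the position of `t` relative to 0 and 1.
  have him : t.im ≠ 0 := by
    intro h0
    have htr : t = (t.re : ℂ) := by apply Complex.ext <;> simp [h0]
    rw [htr] at hx
    rcases lt_or_ge t.re 0 with hn | hn
    · have h1t : (1 : ℂ) - (t.re : ℂ) ≠ 0 := by
        norm_cast; linarith
      refine n2 (mem_segment_of_ratio (s := -t.re / (1 - t.re)) ?_ ?_ ?_)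
      · rw [hx]; push_cast; field_simp; ring
      · exact div_nonneg (by linarith) (by linarith)
      · rw [div_le_one (by linarith)]; linarith
    · rcases le_or_gt t.re 1 with hl | hl
      · exact n1 (mem_segment_of_ratio hx hn hl)
      · have h1t : (t.re : ℂ) ≠ 0 := by
          norm_cast; linarith
        refine n3 (mem_segment_of_ratio (s := (t.re - 1) / t.re) ?_ ?_ ?_)
        · rw [hx]; push_cast; field_simp; ring
        · exact div_nonneg (by linarith) (by linarith)
        · rw [div_le_one (by linarith)]; linarith
  rw [isOctilinear_iff] at o2 o3
  simp only [sub_re, sub_im, one_re, one_im, sub_zero, him, false_or] at o2 o3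
  have key : (t.re = 0 ∧ (t.im = 1 ∨ t.im = -1)) ∨ (t.re = 1 ∧ (t.im = 1 ∨ t.im = -1)) ∨
      (t.re = 1 / 2 ∧ (t.im = 1 / 2 ∨ t.im = -1 / 2)) := by
    rcases o2 with h | h <;> rcases o3 with h' | h'
    · linarith
    · left
      rw [h, abs_eq_abs] at h'
      exact ⟨h, by rcases h' with h' | h' <;> [right; left] <;> linarith⟩
    · right; left
      have hr : t.re = 1 := by linarith
      rw [hr, abs_eq_abs] at h
      exact ⟨hr, by rcases h with h | h <;> [left; right] <;> linarith⟩
    · right; right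
      have hr : t.re = 1 / 2 := by
        rcases abs_eq_abs.1 (h.trans h'.symm) with e | e <;> linarith
      rw [hr, abs_eq_abs] at h
      exact ⟨hr, by rcases h with h | h <;> [left; right] <;> linarith⟩
  have fin : ∀ a b : ℤ, (⟨a, b⟩ : GaussianInt) ∈ apexRatios → t.re = a / 4 → t.im = b / 4 →
      ∃ t ∈ apexRatios, x = p + (q - p) * (t : ℂ) / 4 := by
    intro a b hm ha hb
    refine ⟨_, hm, ?_⟩
    rw [hx, GaussianInt.toComplex_def]
    have : t = (t.re : ℂ) + t.im * I := (re_add_im t).symm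
    rw [this, ha, hb]; push_cast; ring
  rcases key with ⟨hr, hi | hi⟩ | ⟨hr, hi | hi⟩ | ⟨hr, hi | hi⟩
  · exact fin 0 4 (by decide) (by rw [hr]; norm_num) (by rw [hi]; norm_num)
  · exact fin 0 (-4) (by decide) (by rw [hr]; norm_num) (by rw [hi]; norm_num)
  · exact fin 4 4 (by decide) (by rw [hr]; norm_num) (by rw [hi]; norm_num)
  · exact fin 4 (-4) (by decide) (by rw [hr]; norm_num) (by rw [hi]; norm_num)
  · exact fin 2 2 (by decide) (by rw [hr]; norm_num) (by rw [hi]; norm_num)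
  · exact fin 2 (-2) (by decide) (by rw [hr]; norm_num) (by rw [hi]; norm_num)

/-! ### The octahedron minus an edge. -/

/-- The edges of the octahedron with poles `0, 1`, `2, 3`, `4, 5` except for one edge. -/
def punctured : List (Fin 6 × Fin 6) :=
  [(0, 2), (1, 2), (0, 3), (1, 3), (0, 5), (1, 4), (2, 4), (2, 5), (3, 4), (3, 5), (4, 5)]

/-- Positions of the six vertices in units of a sixteenth of the edge from `4` to `5`. -/
def puncturedPos (x y s t : GaussianInt) : Fin 6 → GaussianInt :=
  ![16 + (y - 4) * s, y * t, 4 * x, 4 * y, 0, 16]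

/-- `w` lies between `u` and `v`. -/
def Between (u v w : GaussianInt) : Prop :=
  ((w - u) * star (v - u)).im = 0 ∧ 0 ≤ ((w - u) * star (v - u)).re ∧
    ((w - u) * star (v - u)).re ≤ ((v - u) * star (v - u)).re

instance (u v w : GaussianInt) : Decidable (Between u v w) := by
  unfold Between; infer_instance

/-- An integral placement violating one of the requirements on octilinear drawings. -/
def Defective (g : Fin 6 → GaussianInt) : Prop :=
  (∃ i j, i ≠ j ∧ g i = g j) ∨ (∃ e ∈ punctured, ((g e.1 - g e.2) ^ 4).im ≠ 0) ∨
    ∃ e ∈ punctured, ∃ w, w ≠ e.1 ∧ w ≠ e.2 ∧ Between (g e.1) (g e.2) (g w)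

instance (g : Fin 6 → GaussianInt) : Decidable (Defective g) := by
  unfold Defective; infer_instance

/-- The exhaustive check of the 6^4 candidates. Crossings of edges need not be tested: coinciding
vertices, a non-octilinear edge or a vertex on an edge already occur every time. -/
theorem defective_puncturedPos :
    ∀ x ∈ apexRatios, ∀ y ∈ apexRatios, ∀ s ∈ apexRatios, ∀ t ∈ apexRatios,
      Defective (puncturedPos x y s t) := by
  decide +kernel

theorem Between.mem_segment {u v w : GaussianInt} (h : Between u v w) (huv : u ≠ v) (p d : ℂ) :
    p + d * w ∈ segment ℝ (p + d * u) (p + d * v) := by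
  obtain ⟨h1, h2, h3⟩ := h
  set n : ℤ := ((v - u) * star (v - u)).re with hn
  set m : ℤ := ((w - u) * star (v - u)).re with hm
  have e1 : (v - u) * star (v - u) = (n : GaussianInt) := by
    ext
    · simp [hn]
    · simp; ring
  have e2 : (w - u) * star (v - u) = (m : GaussianInt) := by
    ext
    · simp [hm]
    · rw [h1]; simp
  have hs : star (v - u) ≠ 0 := star_ne_zero.2 (sub_ne_zero.2 huv.symm)
  have hn0 : n ≠ 0 := by
    intro h
    rw [h, Int.cast_zero] at e1
    exact (mul_ne_zero (sub_ne_zero.2 huv.symm) hs) e1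
  have hnpos : 0 < n := lt_of_le_of_ne (h2.trans h3) hn0.symm
  have e3 : (w - u) * n = (v - u) * m := by
    apply mul_right_cancel₀ hs
    rw [mul_right_comm, e2, mul_right_comm, e1, mul_comm]
  have e4 : ((w : ℂ) - u) * n = ((v : ℂ) - u) * m := by
    have := congrArg GaussianInt.toComplex e3
    simpa only [map_mul, map_sub, map_intCast] using this
  have hnC : (n : ℂ) ≠ 0 := by exact_mod_cast hn0
  refine mem_segment_of_ratio (s := (m : ℝ) / n) ?_ ?_ ?_
  · have : (w : ℂ) = u + (v - u) * (m / n) := by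
      field_simp
      linear_combination e4
    rw [this]; push_cast; ring
  · have : (0 : ℝ) < n := by exact_mod_cast hnpos
    have : (0 : ℝ) ≤ m := by exact_mod_cast h2
    positivity
  · rw [div_le_one (by exact_mod_cast hnpos)]
    exact_mod_cast h3

/-- An octahedron without one edge has no bendless octilinear drawing. -/
theorem not_admitsBendlessOctilinear_of_punctured {V : Type*} {G : SimpleGraph V} (f : Fin 6 → V)
    (hf : Function.Injective f) (hadj : ∀ e ∈ punctured, G.Adj (f e.1) (f e.2)) :
    ¬ AdmitsBendlessOctilinear G := by
  rintro ⟨D, hD⟩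
  obtain ⟨P, hP⟩ : ∃ P : Fin 6 → ℂ, ∀ i, P i = D.pos (f i) := ⟨_, fun _ => rfl⟩
  have inj : Function.Injective P := fun i j h =>
    hf (D.pos_injective (by rwa [hP, hP] at h))
  have oct : ∀ e ∈ punctured, IsOctilinear (P e.2 - P e.1) := by
    intro e he
    have h := (hD _ _ (hadj e he)).2
    rw [isOctilinear_iff]
    simp only [sub_im, sub_re, sub_eq_zero, hP]
    rw [abs_sub_comm, abs_sub_comm (D.pos (f e.2)).im]
    tauto
  have nseg : ∀ e ∈ punctured, ∀ w, w ≠ e.1 → w ≠ e.2 → P w ∉ segment ℝ (P e.1) (P e.2) := by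
    intro e he w h1 h2 hw
    rw [hP, hP, hP, ← (hD _ _ (hadj e he)).1] at hw
    rcases D.eq_or_eq_of_pos_mem _ _ _ (hadj e he) hw with h | h
    · exact h1 (hf h)
    · exact h2 (hf h)
  have apex : ∀ i j k, ((i, j) ∈ punctured ∨ (j, i) ∈ punctured) →
      ((i, k) ∈ punctured ∨ (k, i) ∈ punctured) → ((j, k) ∈ punctured ∨ (k, j) ∈ punctured) →
      i ≠ j → i ≠ k → j ≠ k → ∃ t ∈ apexRatios, P k = P i + (P j - P i) * (t : ℂ) / 4 := by
    intro i j k hij hik hjk nij nik njk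
    have o : ∀ i j, ((i, j) ∈ punctured ∨ (j, i) ∈ punctured) → IsOctilinear (P j - P i) := by
      rintro i j (h | h)
      · exact oct (i, j) h
      · simpa using (oct (j, i) h).neg
    have s : ∀ i j k, ((i, j) ∈ punctured ∨ (j, i) ∈ punctured) → k ≠ i → k ≠ j →
        P k ∉ segment ℝ (P i) (P j) := by
      rintro i j k (h | h) h1 h2
      · exact nseg (i, j) h k h1 h2
      · rw [segment_symm]; exact nseg (j, i) h k h2 h1
    exact exists_apexRatio (inj.ne nij) (o i j hij) (o i k hik) (o j k hjk)
      (s i j k hij nik.symm njk.symm) (s k j i hjk.symm nik nij) (s k i j hik.symm njk nij.symm)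
  -- Two triangles stand on the edge 45, and two more on the sides 43 and 53 of the second. Two
  -- successive ratios in quarters explain the unit of one sixteenth.
  obtain ⟨x, hx, ex⟩ := apex 4 5 2 (by decide) (by decide) (by decide) (by decide) (by decide)
    (by decide)
  obtain ⟨y, hy, ey⟩ := apex 4 5 3 (by decide) (by decide) (by decide) (by decide) (by decide)
    (by decide)
  obtain ⟨t, ht, et⟩ := apex 4 3 1 (by decide) (by decide) (by decide) (by decide) (by decide)
    (by decide)
  obtain ⟨s, hs, es⟩ := apex 5 3 0 (by decide) (by decide) (by decide) (by decide) (by decide)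
    (by decide)
  have hd : P 5 - P 4 ≠ 0 := sub_ne_zero.2 (inj.ne (by decide))
  set d := (P 5 - P 4) / 16 with hd16
  have hd0 : d ≠ 0 := div_ne_zero hd (by norm_num)
  have dd : P 5 - P 4 = 16 * d := by rw [hd16]; ring
  have e16 : ((16 : GaussianInt) : ℂ) = 16 := map_ofNat GaussianInt.toComplex 16
  have e4 : ((4 : GaussianInt) : ℂ) = 4 := map_ofNat GaussianInt.toComplex 4
  have coord : ∀ i, P i = P 4 + d * (puncturedPos x y s t i : ℂ) := by
    have h5 : P 5 = P 4 + 16 * d := by rw [← dd]; ring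
    have h3 : P 3 = P 4 + d * (4 * (y : ℂ)) := by rw [ey, dd]; ring
    intro i
    fin_cases i
    · simp only [puncturedPos, Fin.zero_eta, Matrix.cons_val_zero, map_add, map_mul, map_sub, e16, e4]
      rw [es, h3, h5]; ring
    · simp only [puncturedPos, Fin.mk_one, Matrix.cons_val_one, Matrix.cons_val_zero, map_mul]
      rw [et, h3]; ring
    · simp only [puncturedPos, Fin.reduceFinMk, Matrix.cons_val, map_mul, e4]
      rw [ex, dd]; ring
    · simp only [puncturedPos, Fin.reduceFinMk, Matrix.cons_val, map_mul, e4]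
      rw [h3]
    · simp [puncturedPos]
    · simp only [puncturedPos, Fin.reduceFinMk, Matrix.cons_val, e16]
      rw [h5]; ring
  -- The unit `d` is parallel to an edge, so dividing by it preserves octilinearity and moves the
  -- check to Gaussian integers.
  have od : IsOctilinear d := by
    have h1 := oct (4, 5) (by decide)
    have h2 : IsOctilinear 16 := by rw [isOctilinear_iff]; simp
    exact h1.div h2
  rcases defective_puncturedPos x hx y hy s hs t ht with ⟨i, j, hij, h⟩ | ⟨e, he, h⟩ | ⟨e, he, w, h1, h2, h⟩
  · exact hij (inj (by rw [coord i, coord j, h]))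
  · apply h
    have h1 := (oct e he).neg.div od
    have h2 : -(P e.2 - P e.1) / d =
        ((puncturedPos x y s t e.1 - puncturedPos x y s t e.2 : GaussianInt) : ℂ) := by
      rw [coord e.1, coord e.2, map_sub]; field_simp; ring
    rw [h2, IsOctilinear, ← map_pow, ← GaussianInt.intCast_im] at h1
    exact_mod_cast h1
  · have hne : puncturedPos x y s t e.1 ≠ puncturedPos x y s t e.2 := by
      intro h'
      have hne : ∀ e ∈ punctured, e.1 ≠ e.2 := by decide
      exact hne e he (inj (by rw [coord e.1, coord e.2, h']))
    have := h.mem_segment hne (P 4) d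
    rw [← coord, ← coord, ← coord] at this
    exact nseg e he w h1 h2 this

/-! ### Segments and arcs as simple arcs; reversal. -/

theorem I_pow_ne_zero (k : ℕ) : (I : ℂ) ^ k ≠ 0 := pow_ne_zero _ I_ne_zero

theorem IsSimpleArc.symm {p q : ℂ} {S : Set ℂ} (h : IsSimpleArc p q S) : IsSimpleArc q p S := by
  obtain ⟨γ, hγ, rfl⟩ := h
  exact ⟨γ.symm, hγ.comp unitInterval.symm_bijective.injective, γ.symm_range⟩

theorem IsAxisParallelSegment.isSimpleArc {p q a b : ℂ} {S : Set ℂ}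
    (h : IsAxisParallelSegment p q S a b) : IsSimpleArc p q S := by
  obtain ⟨k, l, hl, hq, rfl, -, -⟩ := h
  have hpq : p ≠ q := by
    rw [hq]
    have : (l : ℂ) ≠ 0 := by exact_mod_cast hl.ne'
    simp [this]
  refine ⟨⟨⟨fun t => AffineMap.lineMap p q (t : ℝ), by fun_prop⟩, by simp, by simp⟩, ?_, ?_⟩
  · intro s t hst
    exact Subtype.ext (AffineMap.lineMap_injective ℝ hpq hst)
  · rw [segment_eq_image_lineMap]
    ext z
    constructor
    · rintro ⟨t, rfl⟩
      exact ⟨t, t.2, rfl⟩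
    · rintro ⟨t, ht, rfl⟩
      exact ⟨⟨t, ht⟩, rfl⟩

theorem exp_sign_mul_I {σ : ℝ} (hσ : σ = 1 ∨ σ = -1) (t : ℝ) :
    exp (σ * t * I) = Real.cos t + σ * I * Real.sin t := by
  rcases hσ with rfl | rfl
  · rw [ofReal_one, one_mul, exp_mul_I, ofReal_cos, ofReal_sin]; ring
  · rw [show ((-1 : ℝ) : ℂ) * t * I = (-(t : ℂ)) * I by push_cast; ring, exp_mul_I, cos_neg,
      sin_neg, ofReal_cos, ofReal_sin]; push_cast; ring

theorem exp_quarter_turns {σ : ℝ} (hσ : σ = 1 ∨ σ = -1) (m : ℕ) :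
    exp (σ * ((m * Real.pi / 2 : ℝ) : ℂ) * I) = (σ * I) ^ m := by
  have h1 : exp (σ * ((Real.pi / 2 : ℝ) : ℂ) * I) = σ * I := by
    rw [exp_sign_mul_I hσ]; simp
  rw [← h1, ← exp_nat_mul]
  congr 1; push_cast; ring

theorem IsAxisTangentArc.isSimpleArc {p q a b : ℂ} {S : Set ℂ}
    (h : IsAxisTangentArc p q S a b) : IsSimpleArc p q S := by
  obtain ⟨z, r, σ, k, m, hr, hσ, hm, hp, hq, hS, -, -⟩ := h
  have hm0 : 0 < (m : ℝ) := by rcases hm with rfl | rfl | rfl <;> norm_num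
  have hm3 : (m : ℝ) ≤ 3 := by rcases hm with rfl | rfl | rfl <;> norm_num
  set T : ℝ := m * Real.pi / 2 with hT
  have hT0 : 0 < T := by positivity
  have hT2 : T < 2 * Real.pi := by
    have := Real.pi_pos
    rw [hT]; nlinarith
  refine ⟨⟨⟨fun t => z + r * I ^ k * exp (σ * ((t * T : ℝ) : ℂ) * I), by fun_prop⟩, ?_, ?_⟩,
    ?_, ?_⟩
  · simp [hp]
  · simp only [Set.Icc.coe_one, one_mul, hT, exp_quarter_turns hσ, hq]
  · intro s t hst
    have hst : z + r * I ^ k * exp (σ * ((s * T : ℝ) : ℂ) * I) =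
      z + r * I ^ k * exp (σ * ((t * T : ℝ) : ℂ) * I) := hst
    have hr' : (r : ℂ) * I ^ k ≠ 0 :=
      mul_ne_zero (by exact_mod_cast hr.ne') (I_pow_ne_zero k)
    have h1 := mul_left_cancel₀ hr' (add_left_cancel hst)
    rw [exp_eq_exp_iff_exists_int] at h1
    obtain ⟨n, hn⟩ := h1
    have h2 : σ * (s * T) = σ * (t * T) + n * (2 * Real.pi) := by
      have h3 : ((σ * (s * T) : ℝ) : ℂ) * I = ((σ * (t * T) + n * (2 * Real.pi) : ℝ) : ℂ) * I := by
        push_cast at hn ⊢; rw [hn]; ring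
      exact_mod_cast mul_right_cancel₀ I_ne_zero h3
    have hs := s.2
    have ht := t.2
    have hs0 : 0 ≤ s * T := mul_nonneg hs.1 hT0.le
    have hs1 : s * T ≤ T := mul_le_of_le_one_left hT0.le hs.2
    have ht0 : 0 ≤ t * T := mul_nonneg ht.1 hT0.le
    have ht1 : t * T ≤ T := mul_le_of_le_one_left hT0.le ht.2
    have hpi := Real.pi_pos
    -- The arc is shorter than a full turn, so equal points have equal angles.
    have hn0 : n = 0 := by
      have hlt : |(n : ℝ) * (2 * Real.pi)| < 2 * Real.pi := by
        have : (n : ℝ) * (2 * Real.pi) = σ * (s * T - t * T) := by linarith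
        rw [this, abs_mul, (by rcases hσ with rfl | rfl <;> simp : |σ| = 1), one_mul, abs_lt]
        constructor <;> linarith
      rw [abs_mul, abs_of_pos (by positivity : 0 < 2 * Real.pi)] at hlt
      have : |(n : ℝ)| < 1 := by
        by_contra hc
        nlinarith
      have : |n| < 1 := by exact_mod_cast this
      exact Int.abs_lt_one_iff.1 this
    rw [hn0] at h2
    have hσ0 : σ ≠ 0 := by rcases hσ with rfl | rfl <;> norm_num
    have h4 : σ * (s * T) = σ * (t * T) := by simpa using h2
    exact Subtype.ext (mul_right_cancel₀ hT0.ne' (mul_left_cancel₀ hσ0 h4))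
  · rw [hS]
    ext w
    constructor
    · rintro ⟨t, rfl⟩
      exact ⟨t * T, ⟨mul_nonneg t.2.1 hT0.le, mul_le_of_le_one_left hT0.le t.2.2⟩, rfl⟩
    · rintro ⟨t, ht, rfl⟩
      refine ⟨⟨t / T, div_nonneg ht.1 hT0.le, div_le_one_of_le₀ ht.2 hT0.le⟩, ?_⟩
      change z + r * I ^ k * exp (σ * ((t / T * T : ℝ) : ℂ) * I) = _
      rw [div_mul_cancel₀ _ hT0.ne']

theorem IsAxisParallelSegment.symm {p q a b : ℂ} {S : Set ℂ}
    (h : IsAxisParallelSegment p q S a b) : IsAxisParallelSegment q p S b a := by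
  obtain ⟨k, l, hl, hq, hS, ha, hb⟩ := h
  have h2 : (I : ℂ) ^ (k + 2) = -I ^ k := by rw [pow_add, I_sq]; ring
  refine ⟨k + 2, l, hl, ?_, by rw [hS, segment_symm], by rw [hb, h2], by rw [ha, h2, neg_neg]⟩
  rw [hq, h2]; ring

/-- The reversed arc has the same circle, the opposite orientation, and the old final direction as
its start. -/
theorem IsAxisTangentArc.symm {p q a b : ℂ} {S : Set ℂ}
    (h : IsAxisTangentArc p q S a b) : IsAxisTangentArc q p S b a := by
  obtain ⟨z, r, σ, k, m, hr, hσ, hm, hp, hq, hS, ha, hb⟩ := h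
  obtain ⟨k', hk'⟩ : ∃ k' : ℕ, (I : ℂ) ^ k' = I ^ k * (σ * I) ^ m := by
    rcases hσ with rfl | rfl
    · exact ⟨k + m, by rw [pow_add]; simp⟩
    · refine ⟨k + 3 * m, ?_⟩
      rw [pow_add, pow_mul, I_pow_three]; simp
  have hσσ : (σ : ℂ) * σ = 1 := by rcases hσ with rfl | rfl <;> simp
  have hinv : ((σ : ℂ) * I) ^ m * (((-σ : ℝ) : ℂ) * I) ^ m = 1 := by
    rw [← mul_pow]
    have : ((σ : ℂ) * I) * (((-σ : ℝ) : ℂ) * I) = 1 := by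
      push_cast
      linear_combination hσσ - σ * σ * I_mul_I
    rw [this, one_pow]
  refine ⟨z, r, -σ, k', m, hr, by rcases hσ with rfl | rfl <;> simp, hm, ?_, ?_, ?_, ?_, ?_⟩
  · rw [hq, hk']; ring
  · rw [hp, hk']; linear_combination -((r : ℂ) * I ^ k * hinv)
  · rw [hS, hk']
    have key : ∀ t : ℝ, z + r * (I ^ k * (σ * I) ^ m) * exp (((-σ : ℝ) : ℂ) * t * I) =
        z + r * I ^ k * exp (σ * ((m * Real.pi / 2 - t : ℝ) : ℂ) * I) := by
      intro t
      have e : exp (σ * ((m * Real.pi / 2 - t : ℝ) : ℂ) * I) =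
          (σ * I) ^ m * exp (((-σ : ℝ) : ℂ) * t * I) := by
        rw [← exp_quarter_turns hσ m, ← exp_add]
        congr 1; push_cast; ring
      rw [e]; ring
    ext w
    constructor
    · rintro ⟨t, ht, rfl⟩
      refine ⟨m * Real.pi / 2 - t, ⟨by linarith [ht.2], by linarith [ht.1]⟩, ?_⟩
      simp only [key]
      congr 5; push_cast; ring
    · rintro ⟨t, ht, rfl⟩
      exact ⟨m * Real.pi / 2 - t, ⟨by linarith [ht.2], by linarith [ht.1]⟩, (key t).symm⟩
  · rw [hb, hk']; push_cast; ring
  · rw [ha, hk']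
    generalize (((-σ : ℝ) : ℂ) * I) ^ m = Y at hinv ⊢
    generalize ((σ : ℂ) * I) ^ m = X at hinv ⊢
    push_cast
    linear_combination -((σ : ℂ) * I * I ^ k * hinv)

/-- `S` is one of the curves allowed in bendless smooth orthogonal drawings. -/
def IsSmoothEdge (p q : ℂ) (S : Set ℂ) (a b : ℂ) : Prop :=
  IsAxisParallelSegment p q S a b ∨ IsAxisTangentArc p q S a b

theorem IsSmoothEdge.symm {p q a b : ℂ} {S : Set ℂ} (h : IsSmoothEdge p q S a b) :
    IsSmoothEdge q p S b a :=
  h.imp IsAxisParallelSegment.symm IsAxisTangentArc.symm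

theorem IsSmoothEdge.isSimpleArc {p q a b : ℂ} {S : Set ℂ} (h : IsSmoothEdge p q S a b) :
    IsSimpleArc p q S :=
  h.elim IsAxisParallelSegment.isSimpleArc IsAxisTangentArc.isSimpleArc

/-! ### Assembling and restricting drawings. -/

/-- A graph is drawn by a family of non-crossing smooth edges with distinct ports. -/
theorem admitsBendlessSmoothOrthogonal_of_family {V ι : Type*} {G : SimpleGraph V} (pos : V → ℂ)
    (hpos : Function.Injective pos) (a b : ι → V) (S : ι → Set ℂ) (A B : ι → ℂ)
    (hG : ∀ u v, G.Adj u v → ∃ e, s(a e, b e) = s(u, v))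
    (hS : ∀ e, IsSmoothEdge (pos (a e)) (pos (b e)) (S e) (A e) (B e))
    (hinter : ∀ e f, e ≠ f → ∀ z ∈ S e ∩ S f,
      ∃ w, w ∈ s(a e, b e) ∧ w ∈ s(a f, b f) ∧ z = pos w)
    (huniq : ∀ e f, s(a e, b e) = s(a f, b f) → e = f)
    (hport : ∀ e f w x, (a e = w ∧ A e = x ∨ b e = w ∧ B e = x) →
      (a f = w ∧ A f = x ∨ b f = w ∧ B f = x) → e = f)
    (hdeg : ∀ v, ∃ w, G.Adj v w) :
    AdmitsBendlessSmoothOrthogonal G := by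
  classical
  have hends : ∀ {p q x y : ℂ} {S : Set ℂ}, IsSmoothEdge p q S x y → p ∈ S := by
    intro p q x y S h
    obtain ⟨γ, -, rfl⟩ := h.isSimpleArc
    exact ⟨0, γ.source⟩
  let edge : Sym2 V → Set ℂ := fun s => {z | ∃ e, s(a e, b e) = s ∧ z ∈ S e}
  have hedge : ∀ e, edge s(a e, b e) = S e := by
    intro e
    ext z
    exact ⟨fun ⟨f, hf, hz⟩ => huniq f e hf ▸ hz, fun hz => ⟨e, rfl, hz⟩⟩
  have hsm : ∀ u v, G.Adj u v → ∃ e, s(a e, b e) = s(u, v) ∧ ∃ x y,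
      (a e = u ∧ A e = x ∨ b e = u ∧ B e = x) ∧
      (a e = v ∧ A e = y ∨ b e = v ∧ B e = y) ∧
      IsSmoothEdge (pos u) (pos v) (edge s(u, v)) x y := by
    intro u v huv
    obtain ⟨e, he⟩ := hG u v huv
    refine ⟨e, he, ?_⟩
    rw [← he, hedge]
    rcases Sym2.eq_iff.1 he with ⟨rfl, rfl⟩ | ⟨rfl, rfl⟩
    · exact ⟨A e, B e, Or.inl ⟨rfl, rfl⟩, Or.inr ⟨rfl, rfl⟩, hS e⟩
    · exact ⟨B e, A e, Or.inr ⟨rfl, rfl⟩, Or.inl ⟨rfl, rfl⟩, (hS e).symm⟩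
  have inter : ∀ e ∈ G.edgeSet, ∀ f ∈ G.edgeSet, e ≠ f → ∀ z ∈ edge e ∩ edge f,
      ∃ w, w ∈ e ∧ w ∈ f ∧ z = pos w := by
    rintro e - f - hef z ⟨⟨e', rfl, hz⟩, f', rfl, hz'⟩
    exact hinter e' f' (fun h => hef (by rw [h])) z ⟨hz, hz'⟩
  refine ⟨⟨pos, edge, hpos, ?_, ?_, inter⟩, ?_⟩
  · intro u v huv
    obtain ⟨-, -, x, y, -, -, h⟩ := hsm u v huv
    exact h.isSimpleArc
  · intro u v w huv hw
    -- Since `w` is itself an end of some edge, an edge passing through it would meet that edge in a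
    -- forbidden point.
    obtain ⟨w', hw'⟩ := hdeg w
    have hmem : pos w ∈ edge s(w, w') := by
      obtain ⟨-, -, x, y, -, -, h⟩ := hsm w w' hw'
      exact hends h
    by_cases h : s(u, v) = s(w, w')
    · rcases Sym2.eq_iff.1 h with ⟨rfl, -⟩ | ⟨-, rfl⟩ <;> simp
    · obtain ⟨x, hx, -, hxw⟩ := inter s(u, v) huv s(w, w') hw' h _ ⟨hw, hmem⟩
      rw [hpos hxw]
      exact Sym2.mem_iff.1 hx
  · let port : V → V → ℂ := fun u v =>
      if h : ∃ e, s(a e, b e) = s(u, v) then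
        (if a h.choose = u then A h.choose else B h.choose) else 0
    have hp : ∀ e, a e ≠ b e → port (a e) (b e) = A e ∧ port (b e) (a e) = B e := by
      intro e hne
      have h1 : ∃ f, s(a f, b f) = s(a e, b e) := ⟨e, rfl⟩
      have h2 : ∃ f, s(a f, b f) = s(b e, a e) := ⟨e, Sym2.eq_swap⟩
      have e1 : h1.choose = e := huniq _ _ h1.choose_spec
      have e2 : h2.choose = e := huniq _ _ (h2.choose_spec.trans Sym2.eq_swap)
      constructor
      · simp only [port, dif_pos h1, e1, if_true]
      · simp only [port, dif_pos h2, e2, if_neg hne]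
    have hp' : ∀ u v, G.Adj u v → ∃ e, s(a e, b e) = s(u, v) ∧
        (a e = u ∧ A e = port u v ∨ b e = u ∧ B e = port u v) := by
      intro u v huv
      obtain ⟨e, he⟩ := hG u v huv
      refine ⟨e, he, ?_⟩
      rcases Sym2.eq_iff.1 he with ⟨rfl, rfl⟩ | ⟨rfl, rfl⟩
      · exact Or.inl ⟨rfl, ((hp e huv.ne).1).symm⟩
      · exact Or.inr ⟨rfl, ((hp e huv.ne').2).symm⟩
    refine ⟨port, ?_, ?_⟩
    · intro u v huv
      obtain ⟨e, he⟩ := hG u v huv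
      change IsSmoothEdge (pos u) (pos v) (edge s(u, v)) (port u v) (port v u)
      rw [← he, hedge]
      rcases Sym2.eq_iff.1 he with ⟨rfl, rfl⟩ | ⟨rfl, rfl⟩
      · rw [(hp e huv.ne).1, (hp e huv.ne).2]; exact hS e
      · rw [(hp e huv.ne').1, (hp e huv.ne').2]; exact (hS e).symm
    · intro u v w huv huw h
      obtain ⟨e, he, h1⟩ := hp' u v huv
      obtain ⟨f, hf, h2⟩ := hp' u w huw
      have := hport e f u _ h1 (h ▸ h2)
      subst this
      exact Sym2.congr_right.1 (he.symm.trans hf)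

/-- Planar drawings restrict along injective homomorphisms. -/
def PlanarDrawing.comap {V W : Type*} {G : SimpleGraph V} {H : SimpleGraph W}
    (D : PlanarDrawing G) (f : W → V) (hf : Function.Injective f)
    (hadj : ∀ u v, H.Adj u v → G.Adj (f u) (f v)) : PlanarDrawing H where
  pos := D.pos ∘ f
  edge s := D.edge (s.map f)
  pos_injective := D.pos_injective.comp hf
  edge_isSimpleArc u v h := D.edge_isSimpleArc _ _ (hadj u v h)
  eq_or_eq_of_pos_mem u v w h hw :=
    (D.eq_or_eq_of_pos_mem _ _ _ (hadj u v h) hw).imp (@hf _ _) (@hf _ _)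
  edge_inter := by
    have hmem : ∀ e ∈ H.edgeSet, e.map f ∈ G.edgeSet := by
      intro e
      induction e with
      | _ u v => exact hadj u v
    intro e he g hg hne z hz
    obtain ⟨w, hw, hw', rfl⟩ := D.edge_inter _ (hmem e he) _ (hmem g hg)
      (fun h => hne (Sym2.map.injective hf h)) z hz
    obtain ⟨x, hx, rfl⟩ := Sym2.mem_map.1 hw
    obtain ⟨y, hy, hyx⟩ := Sym2.mem_map.1 hw'
    exact ⟨x, hx, hf hyx ▸ hy, rfl⟩

theorem AdmitsBendlessSmoothOrthogonal.comap {V W : Type*} {G : SimpleGraph V}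
    {H : SimpleGraph W} (h : AdmitsBendlessSmoothOrthogonal G) (f : W → V)
    (hf : Function.Injective f) (hadj : ∀ u v, H.Adj u v → G.Adj (f u) (f v)) :
    AdmitsBendlessSmoothOrthogonal H := by
  obtain ⟨D, port, h1, h2⟩ := h
  exact ⟨D.comap f hf hadj, fun u v => port (f u) (f v), fun u v huv => h1 _ _ (hadj u v huv),
    fun u v w huv huw hp => hf (h2 _ _ _ (hadj u v huv) (hadj u w huw) hp)⟩

/-! ### Integral encoding of smooth edges. -/

/-- The Gaussian integer `i`. -/
def gaussI : GaussianInt := ⟨0, 1⟩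

theorem gaussI_toComplex : (gaussI : ℂ) = I := by
  simp [gaussI, GaussianInt.toComplex_def]

/-- An edge from vertex `src` to vertex `tgt`. It is the segment with displacement `l * I ^ k` if
`m = 0`, and otherwise it consists of `m` quarters of a circle of radius `l`, run through
counterclockwise (`s = 1`) or clockwise (`s = -1`) from direction `I ^ k` of the center. -/
structure EdgeCode where
  src : Fin 12
  tgt : Fin 12
  k : ℕ
  m : ℕ
  s : ℤ
  l : ℕ

namespace EdgeCode

/-- The vector of a segment, or the vector from the center of an arc to its start. -/
def arm (e : EdgeCode) : GaussianInt := (e.l : GaussianInt) * gaussI ^ e.k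

/-- The rotation by a quarter in the sense of the arc. -/
def turn (e : EdgeCode) : GaussianInt := (e.s : GaussianInt) * gaussI

def disp (e : EdgeCode) : GaussianInt :=
  if e.m = 0 then e.arm else e.arm * e.turn ^ e.m - e.arm

def srcPort (e : EdgeCode) : GaussianInt :=
  if e.m = 0 then gaussI ^ e.k else e.turn * gaussI ^ e.k

def tgtPort (e : EdgeCode) : GaussianInt :=
  if e.m = 0 then -gaussI ^ e.k else -(e.turn * gaussI ^ e.k * e.turn ^ e.m)

/-- The two incidences of an edge, with the ports used. -/
def ports (e : EdgeCode) : List (Fin 12 × GaussianInt) :=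
  [(e.src, e.srcPort), (e.tgt, e.tgtPort)]

/-- The curve drawn by an edge whose start is at `p`. -/
def curve (e : EdgeCode) (p : ℂ) : Set ℂ :=
  if e.m = 0 then segment ℝ p (p + e.arm)
  else (fun t : ℝ => p - e.arm + e.arm * exp ((e.s : ℝ) * t * I)) '' Set.Icc 0 (e.m * Real.pi / 2)

def Valid (e : EdgeCode) : Prop := 0 < e.l ∧ (e.s = 1 ∨ e.s = -1) ∧ e.m ≤ 3

instance (e : EdgeCode) : Decidable e.Valid := by unfold Valid; infer_instance

theorem toComplex_arm (e : EdgeCode) : (e.arm : ℂ) = (e.l : ℝ) * I ^ e.k := by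
  simp [arm, gaussI_toComplex]

theorem toComplex_turn (e : EdgeCode) : (e.turn : ℂ) = (e.s : ℝ) * I := by
  simp [turn, gaussI_toComplex]

theorem Valid.sign {e : EdgeCode} (h : e.Valid) : ((e.s : ℝ) = 1 ∨ (e.s : ℝ) = -1) := by
  rcases h.2.1 with h | h <;> simp [h]

theorem Valid.isSmoothEdge {e : EdgeCode} (h : e.Valid) (p : ℂ) :
    IsSmoothEdge p (p + e.disp) (e.curve p) e.srcPort e.tgtPort := by
  have hl : (0 : ℝ) < e.l := by exact_mod_cast h.1
  by_cases hm : e.m = 0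
  · left
    refine ⟨e.k, e.l, hl, ?_, ?_, ?_, ?_⟩
    · rw [disp, if_pos hm, toComplex_arm]
    · rw [curve, disp, if_pos hm, if_pos hm]
    · simp [srcPort, hm, gaussI_toComplex]
    · simp [tgtPort, hm, gaussI_toComplex]
  · right
    refine ⟨p - e.arm, e.l, e.s, e.k, e.m, hl, h.sign, ?_, ?_, ?_, ?_, ?_, ?_⟩
    · have := h.2.2; omega
    · rw [toComplex_arm]; ring
    · rw [disp, if_neg hm, map_sub, map_mul, map_pow, toComplex_turn, toComplex_arm]; ring
    · rw [curve, if_neg hm, toComplex_arm]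
    · rw [srcPort, if_neg hm, map_mul, map_pow, toComplex_turn, gaussI_toComplex]
    · rw [tgtPort, if_neg hm, map_neg, map_mul, map_mul, map_pow, map_pow, toComplex_turn,
        gaussI_toComplex]

theorem mem_curve_add (e : EdgeCode) (p c z : ℂ) : z ∈ e.curve (p + c) ↔ z - c ∈ e.curve p := by
  unfold curve
  split_ifs
  · rw [add_right_comm, add_comm p c, add_comm (p + _) c, ← mem_segment_translate ℝ c (x := z - c),
      add_sub_cancel]
  · constructor
    · rintro ⟨t, ht, rfl⟩
      exact ⟨t, ht, by ring⟩
    · rintro ⟨t, ht, h⟩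
      exact ⟨t, ht, by linear_combination h⟩

end EdgeCode

/-! ### Certificates against crossings. -/

/-- The segment or quarter arc from the first to the second point; for an arc, the third point is
the intersection of the tangents at its endpoints. -/
abbrev Piece : Type := GaussianInt × GaussianInt × GaussianInt

namespace Piece

def ends (A : Piece) : List GaussianInt := [A.1, A.2.1]

def gens (A : Piece) : List GaussianInt := [A.1, A.2.1, A.2.2]

/-- `z` is an inner point of the triangle (or segment) spanned by the piece. -/
def Inner (A : Piece) (z : ℂ) : Prop :=
  ∃ α β γ : ℝ, 0 < α ∧ 0 < β ∧ 0 < γ ∧ α + β + γ = 1 ∧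
    z = α * (A.1 : ℂ) + β * (A.2.1 : ℂ) + γ * (A.2.2 : ℂ)

/-- Endpoints are kept apart from inner points because only they may be shared by two edges. The
third generator of an arc is not covered. -/
def Covers (A : Piece) (z : ℂ) : Prop := (∃ x ∈ A.ends, z = (x : ℂ)) ∨ A.Inner z

/-- The integral linear functional with coefficients `g`. -/
def val (g : ℤ × ℤ) (x : GaussianInt) : ℤ := g.1 * x.re + g.2 * x.im

def valC (g : ℤ × ℤ) (z : ℂ) : ℝ := g.1 * z.re + g.2 * z.im

theorem valC_toComplex (g : ℤ × ℤ) (x : GaussianInt) : valC g x = val g x := by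
  rw [valC, val, ← GaussianInt.intCast_re, ← GaussianInt.intCast_im]; push_cast; rfl

theorem ends_subset_gens (A : Piece) : ∀ x ∈ A.ends, x ∈ A.gens := by
  simp only [ends, gens, List.mem_cons, List.not_mem_nil, or_false]
  tauto

theorem Inner.valC_eq {A : Piece} {z : ℂ} (h : A.Inner z) (g : ℤ × ℤ) :
    ∃ α β γ : ℝ, 0 < α ∧ 0 < β ∧ 0 < γ ∧ α + β + γ = 1 ∧
      valC g z = α * val g A.1 + β * val g A.2.1 + γ * val g A.2.2 := by
  obtain ⟨α, β, γ, h1, h2, h3, h4, rfl⟩ := h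
  refine ⟨α, β, γ, h1, h2, h3, h4, ?_⟩
  simp only [← valC_toComplex, valC, add_re, add_im, re_ofReal_mul, im_ofReal_mul]
  ring

/-- All weights of an inner point are positive, so a single generator below the bound makes the
average strict. -/
theorem Inner.valC_lt {A : Piece} {z : ℂ} (h : A.Inner z) {g : ℤ × ℤ} {M : ℤ}
    (hle : ∀ x ∈ A.gens, val g x ≤ M) (hlt : ∃ x ∈ A.gens, val g x < M) : valC g z < M := by
  obtain ⟨α, β, γ, h1, h2, h3, h4, e⟩ := h.valC_eq g
  simp only [gens, List.mem_cons, List.not_mem_nil, or_false, forall_eq_or_imp, forall_eq,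
    exists_eq_or_imp, exists_eq_left] at hle hlt
  obtain ⟨a, b, c⟩ := hle
  have a' : (val g A.1 : ℝ) ≤ M := by exact_mod_cast a
  have b' : (val g A.2.1 : ℝ) ≤ M := by exact_mod_cast b
  have c' : (val g A.2.2 : ℝ) ≤ M := by exact_mod_cast c
  have a2 := mul_le_mul_of_nonneg_left a' h1.le
  have b2 := mul_le_mul_of_nonneg_left b' h2.le
  have c2 := mul_le_mul_of_nonneg_left c' h3.le
  have hM : (M : ℝ) = α * M + β * M + γ * M := by rw [← add_mul, ← add_mul, h4, one_mul]
  rw [e, hM]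
  rcases hlt with h | h | h
  · have : (val g A.1 : ℝ) < M := by exact_mod_cast h
    have := mul_lt_mul_of_pos_left this h1
    linarith
  · have : (val g A.2.1 : ℝ) < M := by exact_mod_cast h
    have := mul_lt_mul_of_pos_left this h2
    linarith
  · have : (val g A.2.2 : ℝ) < M := by exact_mod_cast h
    have := mul_lt_mul_of_pos_left this h3
    linarith

theorem val_neg (g : ℤ × ℤ) (x : GaussianInt) : val (-g) x = -val g x := by
  simp only [val, Prod.fst_neg, Prod.snd_neg]; ring

theorem valC_neg (g : ℤ × ℤ) (z : ℂ) : valC (-g) z = -valC g z := by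
  simp only [valC, Prod.fst_neg, Prod.snd_neg]; push_cast; ring

theorem Covers.valC_le {A : Piece} {z : ℂ} (h : A.Covers z) {g : ℤ × ℤ} {M : ℤ}
    (hle : ∀ x ∈ A.gens, val g x ≤ M) : valC g z ≤ M := by
  rcases h with ⟨x, hx, rfl⟩ | h
  · rw [valC_toComplex]
    exact_mod_cast hle x (A.ends_subset_gens x hx)
  · by_cases hlt : ∃ x ∈ A.gens, val g x < M
    · exact (h.valC_lt hle hlt).le
    · push Not at hlt
      obtain ⟨α, β, γ, -, -, -, h4, e⟩ := h.valC_eq g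
      have he : ∀ x ∈ A.gens, val g x = M := fun x hx => le_antisymm (hle x hx) (hlt x hx)
      rw [e, he A.1 (by simp [gens]), he A.2.1 (by simp [gens]), he A.2.2 (by simp [gens]),
        ← add_mul, ← add_mul, h4, one_mul]

/-- The functional `g` separates `A` from `B`, except possibly for common endpoints. -/
def Separates (g : ℤ × ℤ) (A B : Piece) : Prop :=
  (∀ x ∈ A.gens, ∀ y ∈ B.gens, val g x ≤ val g y) ∧
    ((∀ x ∈ A.gens, ∀ y ∈ B.gens, val g x < val g y) ∨
      ((∃ x ∈ A.gens, ∀ y ∈ B.gens, val g x < val g y) ∧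
        ∃ y ∈ B.gens, ∀ x ∈ A.gens, val g x < val g y))

instance (g : ℤ × ℤ) (A B : Piece) : Decidable (Separates g A B) := by
  unfold Separates; infer_instance

theorem exists_gen_le {A : Piece} {z : ℂ} (h : A.Covers z) (g : ℤ × ℤ) :
    ∃ x ∈ A.gens, (val g x : ℝ) ≤ valC g z := by
  obtain ⟨x, hx, hm⟩ : ∃ x ∈ A.gens, ∀ y ∈ A.gens, val g x ≤ val g y :=
    (A.gens.toFinset.exists_min_image (val g) ⟨A.1, by simp [gens]⟩).imp fun x hx =>
      ⟨by simpa using hx.1, fun y hy => hx.2 y (by simpa using hy)⟩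
  refine ⟨x, hx, ?_⟩
  have := h.valC_le (g := -g) (M := -val g x) (fun y hy => by
    rw [val_neg]; exact neg_le_neg (hm y hy))
  rw [valC_neg] at this
  push_cast at this
  linarith

theorem exists_le_gen {A : Piece} {z : ℂ} (h : A.Covers z) (g : ℤ × ℤ) :
    ∃ x ∈ A.gens, valC g z ≤ val g x := by
  obtain ⟨x, hx, h⟩ := exists_gen_le h (-g)
  rw [val_neg, valC_neg] at h
  push_cast at h
  exact ⟨x, hx, by linarith⟩

/-- A common point must lie on a separating level line. Each piece has a generator off that line, so
inner points of either piece miss it and only common endpoints remain. -/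
theorem Separates.mem_ends {g : ℤ × ℤ} {A B : Piece} (h : Separates g A B) {z : ℂ}
    (hA : A.Covers z) (hB : B.Covers z) : ∃ x ∈ A.ends, ∃ y ∈ B.ends, x = y ∧ z = (x : ℂ) := by
  obtain ⟨hle, h⟩ := h
  obtain ⟨y, hy, hyz⟩ := exists_gen_le hB g
  obtain ⟨x, hx, hzx⟩ := exists_le_gen hA g
  rcases h with h | ⟨⟨x', hx', h1⟩, ⟨y', hy', h2⟩⟩
  · have := h x hx y hy
    have : (val g x : ℝ) < val g y := by exact_mod_cast this
    linarith
  · rcases hA with ⟨a, ha, rfl⟩ | hA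
    · rcases hB with ⟨b, hb, e⟩ | hB
      · exact ⟨a, ha, b, hb, GaussianInt.toComplex_injective e, rfl⟩
      · have := hB.valC_lt (g := -g) (M := -val g x)
          (fun y hy => by rw [val_neg]; exact neg_le_neg (hle x hx y hy))
          ⟨y', hy', by rw [val_neg]; exact neg_lt_neg (h2 x hx)⟩
        rw [valC_neg] at this
        push_cast at this
        linarith
    · have := hA.valC_lt (g := g) (M := val g y) (fun x hx => hle x hx y hy) ⟨x', hx', h1 y hy⟩
      linarith

end Piece

namespace EdgeCode

def center (e : EdgeCode) (p : GaussianInt) : GaussianInt := p - e.arm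

/-- The decomposition of an edge starting at `p` into segments and quarter arcs. -/
def pieces (e : EdgeCode) (p : GaussianInt) : List Piece :=
  if e.m = 0 then [(p, p + e.arm, p)]
  else (List.range e.m).map fun j =>
    (e.center p + e.arm * e.turn ^ j, e.center p + e.arm * e.turn ^ j * e.turn,
      e.center p + e.arm * e.turn ^ j * (1 + e.turn))

/-- The parameter of an arc is split into a number of quarter turns and a remainder. The final point
is treated separately, since there the floor would be `e.m`, one past the last quarter. -/
theorem Valid.exists_piece {e : EdgeCode} (h : e.Valid) {p : GaussianInt} {z : ℂ}
    (hz : z ∈ e.curve p) : ∃ A ∈ e.pieces p, A.Covers z := by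
  unfold curve at hz
  unfold pieces
  split_ifs at hz ⊢ with hm
  · refine ⟨_, List.mem_singleton_self _, ?_⟩
    rw [segment_eq_image] at hz
    obtain ⟨t, ⟨h0, h1⟩, rfl⟩ := hz
    rcases eq_or_lt_of_le h0 with rfl | h0
    · left; exact ⟨p, by simp [Piece.ends], by simp⟩
    rcases eq_or_lt_of_le h1 with rfl | h1
    · left; exact ⟨p + e.arm, by simp [Piece.ends], by simp⟩
    right
    -- The third generator of a segment repeats `p`, so the weight of `p` is split in two.
    refine ⟨(1 - t) / 2, t, (1 - t) / 2, by linarith, h0, by linarith, by ring, ?_⟩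
    simp only [map_add, real_smul]; push_cast; ring
  · obtain ⟨t, ⟨h0, h1⟩, rfl⟩ := hz
    have hpi := Real.pi_pos
    have hquarter : ∀ (j : ℕ) (θ : ℝ), t = j * Real.pi / 2 + θ →
        (p : ℂ) - e.arm + e.arm * exp ((e.s : ℝ) * t * I) =
          (e.center p : ℂ) + e.arm * e.turn ^ j * (Real.cos θ + e.turn * Real.sin θ) := by
      intro j θ ht
      have : exp ((e.s : ℝ) * t * I) = (e.turn : ℂ) ^ j * (Real.cos θ + e.turn * Real.sin θ) := by
        rw [toComplex_turn, ← exp_quarter_turns h.sign, ← exp_sign_mul_I h.sign, ← exp_add, ht]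
        congr 1; push_cast; ring
      rw [this, center, map_sub]; ring
    rcases eq_or_lt_of_le h1 with h1 | h1
    · obtain ⟨j, hj⟩ : ∃ j, e.m = j + 1 := Nat.exists_eq_succ_of_ne_zero hm
      refine ⟨_, List.mem_map.2 ⟨j, by simp [hj], rfl⟩, Or.inl ⟨_, by
        simp only [Piece.ends, List.mem_cons, List.not_mem_nil, or_false]; right; rfl, ?_⟩⟩
      simp only
      rw [hquarter j (Real.pi / 2) (by rw [h1, hj]; push_cast; ring)]
      simp
    · set j : ℕ := ⌊t / (Real.pi / 2)⌋₊ with hj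
      have hj1 : (j : ℝ) * (Real.pi / 2) ≤ t := by
        rw [← le_div_iff₀ (by positivity)]
        exact Nat.floor_le (by positivity)
      have hj2 : t < (j + 1) * (Real.pi / 2) := by
        rw [← div_lt_iff₀ (by positivity)]
        exact Nat.lt_floor_add_one _
      have hjm : j < e.m := by
        have : (j : ℝ) * (Real.pi / 2) < e.m * (Real.pi / 2) := by linarith
        exact_mod_cast lt_of_mul_lt_mul_right this (by positivity)
      refine ⟨_, List.mem_map.2 ⟨j, List.mem_range.2 hjm, rfl⟩, ?_⟩
      simp only
      obtain ⟨θ, hθ⟩ : ∃ θ, θ = t - j * Real.pi / 2 := ⟨_, rfl⟩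
      rw [hquarter j θ (by rw [hθ]; ring)]
      rcases eq_or_lt_of_le (show 0 ≤ θ by rw [hθ]; linarith) with h0 | h0
      · refine Or.inl ⟨_, by
          simp only [Piece.ends, List.mem_cons, List.not_mem_nil, or_false]; left; rfl, ?_⟩
        simp [← h0]
      · have h2 : θ < Real.pi / 2 := by rw [hθ]; linarith
        have hs : 0 < Real.sin θ := Real.sin_pos_of_pos_of_lt_pi h0 (by linarith)
        have hc : 0 < Real.cos θ := Real.cos_pos_of_mem_Ioo ⟨by linarith, h2⟩
        have hsc := Real.sin_sq_add_cos_sq θ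
        right
        -- Barycentric coordinates of the point (cos θ, sin θ) with respect to (1,0), (0,1), (1,1).
        refine ⟨1 - Real.sin θ, 1 - Real.cos θ, Real.cos θ + Real.sin θ - 1, ?_, ?_, ?_, by ring, ?_⟩
        · nlinarith
        · nlinarith
        · nlinarith [mul_pos hs hc]
        · simp only [map_add, map_mul, map_pow, map_one]; push_cast; ring

theorem norm_sub_center {e : EdgeCode} (hm : e.m ≠ 0) {p : GaussianInt} {z : ℂ}
    (hz : z ∈ e.curve p) : ‖z - e.center p‖ = e.l := by
  rw [curve, if_neg hm] at hz
  obtain ⟨t, -, rfl⟩ := hz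
  have : (p : ℂ) - e.arm + e.arm * exp ((e.s : ℝ) * t * I) - e.center p =
      (e.l : ℝ) * I ^ e.k * exp (((e.s * t : ℝ) : ℂ) * I) := by
    rw [center, map_sub, toComplex_arm]; push_cast; ring
  rw [this, norm_mul, norm_mul, norm_pow, norm_I, norm_exp_ofReal_mul_I]
  simp

/-- The circles carrying two arcs are disjoint. -/
def CirclesDisjoint (e f : EdgeCode) (p q : GaussianInt) : Prop :=
  e.m ≠ 0 ∧ f.m ≠ 0 ∧ ((e.l + f.l : ℤ) ^ 2 < (e.center p - f.center q).norm ∨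
    (e.center p - f.center q).norm < (e.l - f.l : ℤ) ^ 2)

instance (e f : EdgeCode) (p q : GaussianInt) : Decidable (CirclesDisjoint e f p q) := by
  unfold CirclesDisjoint; infer_instance

/-- By the triangle inequality, circles meet only if the distance of their centers is between the
difference and the sum of the radii. This handles, for instance, the concentric half circles of
`middleBlock`, whose bounding triangles overlap. -/
theorem CirclesDisjoint.disjoint {e f : EdgeCode} {p q : GaussianInt}
    (h : CirclesDisjoint e f p q) {z : ℂ} (h1 : z ∈ e.curve p)
    (h2 : z ∈ f.curve q) : False := by
  obtain ⟨hm, hn, h⟩ := h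
  have a := norm_sub_center hm h1
  have b := norm_sub_center hn h2
  have c : (((e.center p - f.center q).norm : ℤ) : ℝ) =
      ‖(z - f.center q) - (z - e.center p)‖ ^ 2 := by
    rw [GaussianInt.intCast_real_norm, Complex.sq_norm, map_sub]
    congr 1; ring
  have d1 := norm_sub_le (z - f.center q) (z - e.center p)
  have d2 := abs_norm_sub_norm_le (z - f.center q) (z - e.center p)
  rw [a, b] at d1 d2
  set N := ‖(z - f.center q) - (z - e.center p)‖
  have hN : 0 ≤ N := norm_nonneg _
  rcases h with h | h
  · have h : ((e.l + f.l : ℤ) ^ 2 : ℝ) < N ^ 2 := by rw [← c]; exact_mod_cast h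
    push_cast at h
    have hel : (0 : ℝ) ≤ e.l := Nat.cast_nonneg _
    have hfl : (0 : ℝ) ≤ f.l := Nat.cast_nonneg _
    nlinarith
  · have h : N ^ 2 < ((e.l - f.l : ℤ) ^ 2 : ℝ) := by rw [← c]; exact_mod_cast h
    push_cast at h
    have := abs_le.1 d2
    nlinarith

/-- Functionals sufficient to separate the pieces used below. -/
def functionals : List (ℤ × ℤ) :=
  [(1, 0), (0, 1), (-1, 0), (0, -1), (1, 1), (1, -1), (-1, 1), (-1, -1), (2, 1), (1, 2), (2, -1),
    (1, -2), (-2, -1), (-1, -2), (-2, 1), (-1, 2)]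

/-- A certificate that two edges meet at most in common endvertices. -/
def Apart (pos : Fin 12 → GaussianInt) (e f : EdgeCode) : Prop :=
  CirclesDisjoint e f (pos e.src) (pos f.src) ∨
    ∀ A ∈ e.pieces (pos e.src), ∀ B ∈ f.pieces (pos f.src),
      (∃ g ∈ functionals, Piece.Separates g A B) ∧
        ∀ x ∈ A.ends, ∀ y ∈ B.ends, x = y →
          ∃ w ∈ [e.src, e.tgt], w ∈ [f.src, f.tgt] ∧ x = pos w

instance (pos : Fin 12 → GaussianInt) (e f : EdgeCode) : Decidable (Apart pos e f) := by
  unfold Apart; infer_instance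

theorem Apart.exists_vertex {pos : Fin 12 → GaussianInt} {e f : EdgeCode} (h : Apart pos e f)
    (he : e.Valid) (hf : f.Valid) {z : ℂ} (h1 : z ∈ e.curve (pos e.src))
    (h2 : z ∈ f.curve (pos f.src)) :
    ∃ w, w ∈ s(e.src, e.tgt) ∧ w ∈ s(f.src, f.tgt) ∧ z = (pos w : ℂ) := by
  rcases h with h | h
  · exact (h.disjoint h1 h2).elim
  · obtain ⟨A, hA, hzA⟩ := he.exists_piece h1
    obtain ⟨B, hB, hzB⟩ := hf.exists_piece h2
    obtain ⟨⟨g, -, hg⟩, hends⟩ := h A hA B hB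
    obtain ⟨x, hx, y, hy, hxy, rfl⟩ := hg.mem_ends hzA hzB
    obtain ⟨w, hw, hw', rfl⟩ := hends x hx y hy hxy
    exact ⟨w, by simpa using hw, by simpa using hw', rfl⟩

/-- A certificate that an edge is on the smaller side of the vertex `c` with respect to the
functional `g`, and touches that level only in `c`. -/
def Below (pos : Fin 12 → GaussianInt) (g : ℤ × ℤ) (c : Fin 12) (e : EdgeCode) : Prop :=
  ∀ A ∈ e.pieces (pos e.src), (∀ x ∈ A.gens, Piece.val g x ≤ Piece.val g (pos c)) ∧
    (∃ x ∈ A.gens, Piece.val g x < Piece.val g (pos c)) ∧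
    ∀ x ∈ A.ends, Piece.val g x = Piece.val g (pos c) → c ∈ [e.src, e.tgt] ∧ x = pos c

instance (pos : Fin 12 → GaussianInt) (g : ℤ × ℤ) (c : Fin 12) (e : EdgeCode) :
    Decidable (Below pos g c e) := by
  unfold Below; infer_instance

theorem Below.valC_lt_or {pos : Fin 12 → GaussianInt} {g : ℤ × ℤ} {c : Fin 12} {e : EdgeCode}
    (h : Below pos g c e) (he : e.Valid) {z : ℂ} (hz : z ∈ e.curve (pos e.src)) :
    Piece.valC g z < Piece.valC g (pos c) ∨ (c ∈ s(e.src, e.tgt) ∧ z = (pos c : ℂ)) := by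
  obtain ⟨A, hA, hzA⟩ := he.exists_piece hz
  obtain ⟨h1, h2, h3⟩ := h A hA
  rw [Piece.valC_toComplex]
  rcases hzA with ⟨x, hx, rfl⟩ | hzA
  · rw [Piece.valC_toComplex]
    rcases (h1 x (A.ends_subset_gens x hx)).lt_or_eq with h | h
    · left; exact_mod_cast h
    · right
      obtain ⟨h4, rfl⟩ := h3 x hx h
      exact ⟨by simpa using h4, rfl⟩
  · left
    exact hzA.valC_lt h1 h2

end EdgeCode

/-! ### The blocks and their drawings. -/

/-- A graph on twelve vertices drawn with integral coordinates. In a chain, it is linked to the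
preceding block by the vertex `0` and to the following one by the vertex `11`. -/
structure Block where
  pos : Fin 12 → GaussianInt
  edges : List EdgeCode

namespace Block

def graph (B : Block) : SimpleGraph (Fin 12) where
  Adj u v := u ≠ v ∧ ∃ e ∈ B.edges, s(e.src, e.tgt) = s(u, v)
  symm := ⟨fun _ _ ⟨h, e, he, h'⟩ => ⟨h.symm, e, he, h'.trans Sym2.eq_swap⟩⟩
  loopless := ⟨fun _ h => h.1 rfl⟩

instance (B : Block) : DecidableRel B.graph.Adj := fun u v => by
  unfold graph; infer_instance

/-- The block is drawn by non-crossing smooth edges with distinct ports. -/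
structure IsDrawn (B : Block) : Prop where
  valid : ∀ e ∈ B.edges, e.Valid ∧ B.pos e.tgt = B.pos e.src + e.disp ∧ e.src ≠ e.tgt
  pairwise : B.edges.Pairwise fun e f => EdgeCode.Apart B.pos e f ∧
    s(e.src, e.tgt) ≠ s(f.src, f.tgt) ∧ ∀ x ∈ e.ports, x ∉ f.ports
  pos_injective : Function.Injective B.pos
  degree : ∀ v, v ≠ 0 → v ≠ 11 → (Finset.univ.filter (B.graph.Adj v)).card = 4

/-- The vertex `0` is the leftmost point of the drawing, and the ports pointing up and left are
free there. -/
structure IsLeftEnd (B : Block) : Prop where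
  below : ∀ e ∈ B.edges, EdgeCode.Below B.pos (-1, 0) 0 e
  re_lt : ∀ v, v ≠ 0 → (B.pos 0).re < (B.pos v).re
  ports : ∀ e ∈ B.edges, ∀ x ∈ e.ports, x.1 = 0 → x.2 ∈ [1, -gaussI]
  pos_zero : B.pos 0 = 0
  degree : (Finset.univ.filter (B.graph.Adj 0)).card = 2

/-- The vertex `11` is the rightmost point of the drawing, and the ports pointing down and right
are free there. -/
structure IsRightEnd (B : Block) : Prop where
  below : ∀ e ∈ B.edges, EdgeCode.Below B.pos (1, 0) 11 e
  re_lt : ∀ v, v ≠ 11 → (B.pos v).re < (B.pos 11).re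
  ports : ∀ e ∈ B.edges, ∀ x ∈ e.ports, x.1 = 11 → x.2 ∈ [-1, gaussI]
  degree : (Finset.univ.filter (B.graph.Adj 11)).card = 2

end Block

/-- Vertices 0 to 5 form the octahedron minus the edge 01. Vertices 6 to 11 form an octahedron
without the edges from 11 to 9 and 10; the edges from 10 to 0 and from 1 to 9 restore the degrees,
except at 11. -/
def leftBlock : Block where
  pos := ![⟨-28, 28⟩, ⟨-30, 25⟩, ⟨-28, 27⟩, ⟨-30, 26⟩, ⟨-29, 27⟩, ⟨-29, 26⟩,
    ⟨-22, 11⟩, ⟨-11, 11⟩, ⟨-11, 0⟩, ⟨-33, 22⟩, ⟨-22, 22⟩, ⟨0, 0⟩]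
  edges := [
    ⟨6, 7, 0, 0, 1, 11⟩, ⟨6, 8, 2, 1, 1, 11⟩, ⟨6, 9, 3, 1, -1, 11⟩, ⟨6, 10, 1, 0, 1, 11⟩,
    ⟨7, 8, 3, 0, 1, 11⟩, ⟨8, 9, 0, 3, -1, 22⟩, ⟨9, 10, 0, 0, 1, 11⟩, ⟨10, 7, 1, 1, -1, 11⟩,
    ⟨11, 7, 0, 1, 1, 11⟩, ⟨11, 8, 2, 0, 1, 11⟩, ⟨10, 0, 0, 1, 1, 6⟩, ⟨1, 9, 1, 1, 1, 3⟩,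
    ⟨0, 2, 3, 0, 1, 1⟩, ⟨0, 3, 0, 3, 1, 2⟩, ⟨1, 2, 2, 3, 1, 2⟩, ⟨1, 3, 1, 0, 1, 1⟩,
    ⟨0, 4, 1, 1, 1, 1⟩, ⟨1, 5, 3, 1, 1, 1⟩, ⟨2, 5, 0, 1, -1, 1⟩, ⟨2, 4, 2, 0, 1, 1⟩,
    ⟨3, 5, 0, 0, 1, 1⟩, ⟨3, 4, 2, 1, -1, 1⟩, ⟨5, 4, 1, 0, 1, 1⟩]

/-- Two octahedra, each with two edges removed at its linking vertex, joined by two concentric half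
circles. -/
def middleBlock : Block where
  pos := ![⟨0, 0⟩, ⟨6, 2⟩, ⟨4, 2⟩, ⟨2, 0⟩, ⟨2, -2⟩, ⟨4, 0⟩,
    ⟨18, 0⟩, ⟨20, 0⟩, ⟨20, -2⟩, ⟨16, 2⟩, ⟨18, 2⟩, ⟨22, -2⟩]
  edges := [
    ⟨6, 7, 0, 0, 1, 2⟩, ⟨6, 8, 2, 1, 1, 2⟩, ⟨6, 9, 3, 1, -1, 2⟩, ⟨6, 10, 1, 0, 1, 2⟩,
    ⟨7, 8, 3, 0, 1, 2⟩, ⟨8, 9, 0, 3, -1, 4⟩, ⟨9, 10, 0, 0, 1, 2⟩, ⟨10, 7, 1, 1, -1, 2⟩,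
    ⟨11, 7, 0, 1, 1, 2⟩, ⟨11, 8, 2, 0, 1, 2⟩, ⟨5, 4, 0, 1, -1, 2⟩, ⟨5, 3, 2, 0, 1, 2⟩,
    ⟨5, 2, 1, 0, 1, 2⟩, ⟨5, 1, 3, 1, 1, 2⟩, ⟨4, 3, 1, 0, 1, 2⟩, ⟨3, 2, 2, 1, -1, 2⟩,
    ⟨2, 1, 0, 0, 1, 2⟩, ⟨1, 4, 1, 3, -1, 4⟩, ⟨0, 4, 2, 1, 1, 2⟩, ⟨0, 3, 0, 0, 1, 2⟩,
    ⟨9, 1, 0, 2, 1, 5⟩, ⟨10, 2, 0, 2, 1, 7⟩]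

def rightBlock : Block where
  pos := ![⟨0, 0⟩, ⟨22, -22⟩, ⟨33, -22⟩, ⟨11, 0⟩, ⟨11, -11⟩, ⟨22, -11⟩,
    ⟨29, -26⟩, ⟨29, -27⟩, ⟨30, -26⟩, ⟨28, -27⟩, ⟨30, -25⟩, ⟨28, -28⟩]
  edges := [
    ⟨5, 4, 2, 0, 1, 11⟩, ⟨5, 3, 0, 1, 1, 11⟩, ⟨5, 2, 1, 1, -1, 11⟩, ⟨5, 1, 3, 0, 1, 11⟩,
    ⟨4, 3, 1, 0, 1, 11⟩, ⟨3, 2, 2, 3, -1, 22⟩, ⟨2, 1, 2, 0, 1, 11⟩, ⟨1, 4, 3, 1, -1, 11⟩,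
    ⟨0, 4, 2, 1, 1, 11⟩, ⟨0, 3, 0, 0, 1, 11⟩, ⟨1, 11, 2, 1, 1, 6⟩, ⟨10, 2, 3, 1, 1, 3⟩,
    ⟨11, 9, 1, 0, 1, 1⟩, ⟨11, 8, 2, 3, 1, 2⟩, ⟨10, 9, 0, 3, 1, 2⟩, ⟨10, 8, 3, 0, 1, 1⟩,
    ⟨11, 7, 3, 1, 1, 1⟩, ⟨10, 6, 1, 1, 1, 1⟩, ⟨9, 6, 2, 1, -1, 1⟩, ⟨9, 7, 0, 0, 1, 1⟩,
    ⟨8, 6, 2, 0, 1, 1⟩, ⟨8, 7, 0, 1, -1, 1⟩, ⟨6, 7, 3, 0, 1, 1⟩]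

theorem leftBlock_isDrawn : leftBlock.IsDrawn :=
  ⟨by decide +kernel, by decide +kernel, by decide +kernel, by decide +kernel⟩

theorem middleBlock_isDrawn : middleBlock.IsDrawn :=
  ⟨by decide +kernel, by decide +kernel, by decide +kernel, by decide +kernel⟩

theorem rightBlock_isDrawn : rightBlock.IsDrawn :=
  ⟨by decide +kernel, by decide +kernel, by decide +kernel, by decide +kernel⟩

theorem middleBlock_isLeftEnd : middleBlock.IsLeftEnd :=
  ⟨by decide +kernel, by decide +kernel, by decide +kernel, by decide +kernel, by decide +kernel⟩

theorem rightBlock_isLeftEnd : rightBlock.IsLeftEnd :=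
  ⟨by decide +kernel, by decide +kernel, by decide +kernel, by decide +kernel, by decide +kernel⟩

theorem leftBlock_isRightEnd : leftBlock.IsRightEnd :=
  ⟨by decide +kernel, by decide +kernel, by decide +kernel, by decide +kernel⟩

theorem middleBlock_isRightEnd : middleBlock.IsRightEnd :=
  ⟨by decide +kernel, by decide +kernel, by decide +kernel, by decide +kernel⟩

theorem leftBlock_degree_zero :
    (Finset.univ.filter (leftBlock.graph.Adj 0)).card = 4 := by decide +kernel

theorem rightBlock_degree_last :
    (Finset.univ.filter (rightBlock.graph.Adj 11)).card = 4 := by decide +kernel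

theorem leftBlock_hamiltonian :
    ∃ h : Fin 12 → Fin 12, Function.Bijective h ∧ ∀ i, leftBlock.graph.Adj (h i) (h (i + 1)) :=
  ⟨![9, 1, 2, 5, 4, 3, 0, 10, 6, 7, 11, 8], by decide +kernel, by decide +kernel⟩

theorem middleBlock_hamiltonian :
    ∃ h : Fin 12 → Fin 12, Function.Bijective h ∧ ∀ i, middleBlock.graph.Adj (h i) (h (i + 1)) :=
  ⟨![11, 7, 6, 10, 2, 3, 0, 4, 5, 1, 9, 8], by decide +kernel, by decide +kernel⟩

/-- The last block of a chain is a rotated copy of the first. -/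
def rightBlockIso : rightBlock.graph ≃g leftBlock.graph where
  toEquiv := Fin.revPerm
  map_rel_iff' {a b} := by
    have h : ∀ u v, leftBlock.graph.Adj u.rev v.rev ↔ rightBlock.graph.Adj u v := by
      decide +kernel
    exact h a b

theorem rightBlock_hamiltonian :
    ∃ h : Fin 12 → Fin 12, Function.Bijective h ∧ ∀ i, rightBlock.graph.Adj (h i) (h (i + 1)) := by
  obtain ⟨h, hb, ha⟩ := leftBlock_hamiltonian
  exact ⟨rightBlockIso.symm ∘ h, rightBlockIso.symm.bijective.comp hb,
    fun i => rightBlockIso.symm.map_rel_iff.2 (ha i)⟩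

/-! ### Biconnectedness from Hamiltonian cycles. -/

/-- A graph with a Hamiltonian cycle is biconnected. -/
theorem isBiconnected_of_hamiltonian {V : Type*} {G : SimpleGraph V} {N : ℕ} [NeZero N]
    (hN : 3 ≤ N) (h : ZMod N → V) (hb : Function.Bijective h) (ha : ∀ i, G.Adj (h i) (h (i + 1))) :
    IsBiconnected G := by
  have : Nonempty V := ⟨h 0⟩
  have hreach : ∀ (i : ZMod N) (m : ℕ), G.Reachable (h i) (h (i + m)) := by
    intro i m
    induction m with
    | zero => simp
    | succ m ih =>
      refine ih.trans (SimpleGraph.Adj.reachable ?_)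
      have := ha (i + m)
      rwa [add_assoc, ← Nat.cast_succ] at this
  have hall : ∀ i j : ZMod N, ∃ m : ℕ, m < N ∧ j = i + m := by
    intro i j
    exact ⟨(j - i).val, ZMod.val_lt _, by rw [ZMod.natCast_zmod_val]; ring⟩
  refine ⟨⟨fun u v => ?_⟩, ?_, ?_⟩
  · obtain ⟨i, rfl⟩ := hb.2 u
    obtain ⟨j, rfl⟩ := hb.2 v
    obtain ⟨m, -, rfl⟩ := hall i j
    exact hreach i m
  · have : Finite V := Finite.of_surjective h hb.2
    have : Nat.card V = N := by
      rw [← Nat.card_congr (Equiv.ofBijective h hb), Nat.card_zmod]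
    rw [ENat.card_eq_coe_natCard, this]
    exact_mod_cast hN
  · intro d
    obtain ⟨i, rfl⟩ := hb.2 d
    have hne : ∀ m : ℕ, m + 1 < N → h (i + 1 + m) ∈ ({h i}ᶜ : Set V) := by
      intro m hm he
      have h1 : i + 1 + (m : ZMod N) = i := hb.1 he
      have h2 : ((m + 1 : ℕ) : ZMod N) = 0 := by
        push_cast; linear_combination h1
      rw [ZMod.natCast_eq_zero_iff] at h2
      exact absurd (Nat.le_of_dvd (by omega) h2) (by omega)
    -- Without `h i` the cycle becomes a path starting at its successor.
    have hpath : ∀ m : ℕ, ∀ hm : m + 1 < N, (G.induce ({h i}ᶜ : Set V)).Reachable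
        ⟨h (i + 1 + (0 : ℕ)), hne 0 (by omega)⟩ ⟨h (i + 1 + m), hne m hm⟩ := by
      intro m
      induction m with
      | zero => intro _; exact SimpleGraph.Reachable.refl _
      | succ m ih =>
        intro hm
        refine (ih (by omega)).trans (SimpleGraph.Adj.reachable ?_)
        have := ha (i + 1 + m)
        rw [add_assoc (i + 1), ← Nat.cast_succ] at this
        exact this
    have hroot : ∀ u : ({h i}ᶜ : Set V), (G.induce ({h i}ᶜ : Set V)).Reachable
        ⟨h (i + 1 + (0 : ℕ)), hne 0 (by omega)⟩ u := by
      rintro ⟨u, hu⟩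
      obtain ⟨j, rfl⟩ := hb.2 u
      obtain ⟨m, hm, rfl⟩ := hall (i + 1) j
      refine hpath m ?_
      by_contra hc
      refine hu (congrArg h ?_)
      have h3 : ((m + 1 : ℕ) : ZMod N) = 0 := by
        rw [show m + 1 = N by omega, ZMod.natCast_self]
      push_cast at h3
      linear_combination h3
    have : Nonempty ({h i}ᶜ : Set V) := ⟨⟨_, hne 0 (by omega)⟩⟩
    exact ⟨fun u v => (hroot u).symm.trans (hroot v)⟩

/-- The certificates cover pairs in list order only; the properties they imply are symmetric. -/
theorem Block.IsDrawn.rel {B : Block} (h : B.IsDrawn) {e f : EdgeCode} (he : e ∈ B.edges)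
    (hf : f ∈ B.edges) (hne : e ≠ f) :
    (∀ z, z ∈ e.curve (B.pos e.src) → z ∈ f.curve (B.pos f.src) →
      ∃ w, w ∈ s(e.src, e.tgt) ∧ w ∈ s(f.src, f.tgt) ∧ z = (B.pos w : ℂ)) ∧
    s(e.src, e.tgt) ≠ s(f.src, f.tgt) ∧ ∀ x ∈ e.ports, x ∉ f.ports := by
  let R : EdgeCode → EdgeCode → Prop := fun e f => e ∈ B.edges → f ∈ B.edges →
    (∀ z, z ∈ e.curve (B.pos e.src) → z ∈ f.curve (B.pos f.src) →
      ∃ w, w ∈ s(e.src, e.tgt) ∧ w ∈ s(f.src, f.tgt) ∧ z = (B.pos w : ℂ)) ∧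
    s(e.src, e.tgt) ≠ s(f.src, f.tgt) ∧ ∀ x ∈ e.ports, x ∉ f.ports
  have : Std.Symm R := ⟨fun e f h he hf => by
    obtain ⟨h1, h2, h3⟩ := h hf he
    refine ⟨fun z hz hz' => ?_, h2.symm, fun x hx hx' => h3 x hx' hx⟩
    obtain ⟨w, hw, hw', rfl⟩ := h1 z hz' hz
    exact ⟨w, hw', hw, rfl⟩⟩
  have hp : B.edges.Pairwise R := h.pairwise.imp fun ⟨h1, h2, h3⟩ he hf =>
    ⟨fun z hz hz' => h1.exists_vertex (h.valid _ he).1 (h.valid _ hf).1 hz hz', h2, h3⟩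
  exact hp.forall he hf hne he hf

theorem Block.degree_eq (B : Block) (v : Fin 12) :
    (B.graph.neighborSet v).ncard = (Finset.univ.filter (B.graph.Adj v)).card := by
  rw [← Set.ncard_coe_finset]
  congr 1
  ext w
  simp

/-! ### The chain as a graph. -/

/-- The `i`-th block of a chain with `k` inner blocks. -/
def chainBlock (k i : ℕ) : Block :=
  if i = 0 then leftBlock else if i = k + 1 then rightBlock else middleBlock

theorem chainBlock_isDrawn (k i : ℕ) : (chainBlock k i).IsDrawn := by
  unfold chainBlock
  split_ifs
  exacts [leftBlock_isDrawn, rightBlock_isDrawn, middleBlock_isDrawn]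

theorem chainBlock_isLeftEnd (k : ℕ) {i : ℕ} (hi : i ≠ 0) : (chainBlock k i).IsLeftEnd := by
  rw [chainBlock, if_neg hi]
  split_ifs
  exacts [rightBlock_isLeftEnd, middleBlock_isLeftEnd]

theorem chainBlock_isRightEnd {k i : ℕ} (hi : i ≠ k + 1) : (chainBlock k i).IsRightEnd := by
  unfold chainBlock
  rw [if_neg hi]
  split_ifs
  exacts [leftBlock_isRightEnd, middleBlock_isRightEnd]

theorem chainBlock_hamiltonian (k i : ℕ) : ∃ h : Fin 12 → Fin 12, Function.Bijective h ∧
    ∀ j, (chainBlock k i).graph.Adj (h j) (h (j + 1)) := by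
  unfold chainBlock
  split_ifs
  exacts [leftBlock_hamiltonian, rightBlock_hamiltonian, middleBlock_hamiltonian]

/-- The vertex `v` of the `i`-th block of a chain. -/
def chainVertex {k : ℕ} (i : Fin (k + 2)) (v : Fin 12) : Fin (11 * k + 23) :=
  ⟨11 * i + v, by omega⟩

/-- The chain with `k` inner blocks. -/
def chain (k : ℕ) : SimpleGraph (Fin (11 * k + 23)) where
  Adj x y := x ≠ y ∧ ∃ i : Fin (k + 2), ∃ e ∈ (chainBlock k i).edges,
    s(chainVertex i e.src, chainVertex i e.tgt) = s(x, y)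
  symm := ⟨fun _ _ ⟨h, i, e, he, h'⟩ => ⟨h.symm, i, e, he, h'.trans Sym2.eq_swap⟩⟩
  loopless := ⟨fun _ h => h.1 rfl⟩

section
variable {k : ℕ}

theorem chainVertex_injective (i : Fin (k + 2)) : Function.Injective (chainVertex i) := by
  intro a b h
  have := congrArg Fin.val h
  simp only [chainVertex] at this
  exact Fin.ext (by omega)

theorem chainVertex_eq_of_lt {i j : Fin (k + 2)} (hij : i < j) {a b : Fin 12}
    (h : chainVertex i a = chainVertex j b) : (j : ℕ) = i + 1 ∧ a = 11 ∧ b = 0 := by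
  have h := congrArg Fin.val h
  simp only [chainVertex] at h
  have hij : (i : ℕ) < j := hij
  refine ⟨by omega, Fin.ext ?_, Fin.ext ?_⟩
  · change (a : ℕ) = 11; omega
  · change (b : ℕ) = 0; omega

theorem chainVertex_succ {i j : Fin (k + 2)} (hij : (j : ℕ) = i + 1) :
    chainVertex i 11 = chainVertex j 0 := by
  refine Fin.ext ?_
  change 11 * (i : ℕ) + 11 = 11 * (j : ℕ) + 0
  omega

theorem exists_chainVertex (n : Fin (11 * k + 23)) : ∃ i a, n = chainVertex (k := k) i a := by
  by_cases h : (n : ℕ) / 11 < k + 2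
  · exact ⟨⟨n / 11, h⟩, ⟨n % 11, by omega⟩, Fin.ext (by simp only [chainVertex]; omega)⟩
  · exact ⟨Fin.last _, 11, Fin.ext (by
      change (n : ℕ) = 11 * (k + 1) + 11; omega)⟩

/-- Different blocks share at most one vertex, so an edge determines its block. -/
theorem block_eq_of_shared {i j : Fin (k + 2)} {a b c d : Fin 12} (hab : a ≠ b)
    (h1 : chainVertex i a = chainVertex j c) (h2 : chainVertex i b = chainVertex j d) : i = j := by
  rcases lt_trichotomy i j with h | h | h
  · exact (hab ((chainVertex_eq_of_lt h h1).2.1.trans (chainVertex_eq_of_lt h h2).2.1.symm)).elim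
  · exact h
  · exact (hab ((chainVertex_eq_of_lt h h1.symm).2.2.trans
      (chainVertex_eq_of_lt h h2.symm).2.2.symm)).elim

theorem chain_adj_iff {x y : Fin (11 * k + 23)} : (chain k).Adj x y ↔
    ∃ i a b, x = chainVertex i a ∧ y = chainVertex i b ∧ (chainBlock k i).graph.Adj a b := by
  constructor
  · rintro ⟨hne, i, e, he, h⟩
    have hst := ((chainBlock_isDrawn k i).valid e he).2.2
    rcases Sym2.eq_iff.1 h with ⟨rfl, rfl⟩ | ⟨rfl, rfl⟩
    · exact ⟨i, _, _, rfl, rfl, hst, e, he, rfl⟩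
    · exact ⟨i, _, _, rfl, rfl, hst.symm, e, he, Sym2.eq_swap⟩
  · rintro ⟨i, a, b, rfl, rfl, hne, e, he, h⟩
    refine ⟨(chainVertex_injective i).ne hne, i, e, he, ?_⟩
    rcases Sym2.eq_iff.1 h with ⟨rfl, rfl⟩ | ⟨rfl, rfl⟩
    · rfl
    · exact Sym2.eq_swap

theorem chain_adj_chainVertex {i : Fin (k + 2)} {a b : Fin 12} :
    (chain k).Adj (chainVertex i a) (chainVertex i b) ↔ (chainBlock k i).graph.Adj a b := by
  rw [chain_adj_iff]
  constructor
  · rintro ⟨j, c, d, h1, h2, h⟩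
    have hij : j = i := block_eq_of_shared h.ne h1.symm h2.symm
    subst hij
    rwa [chainVertex_injective _ h1, chainVertex_injective _ h2]
  · exact fun h => ⟨i, a, b, rfl, rfl, h⟩

/-- The vertex sets of the blocks of a chain. -/
def chainSet (k : ℕ) (i : Fin (k + 2)) : Set (Fin (11 * k + 23)) := Set.range (chainVertex i)

/-- The blocks of a chain are induced subgraphs. -/
noncomputable def chainIso (k : ℕ) (i : Fin (k + 2)) :
    (chain k).induce (chainSet k i) ≃g (chainBlock k i).graph :=
  RelIso.symm
    { toEquiv := Equiv.ofInjective _ (chainVertex_injective i)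
      map_rel_iff' := chain_adj_chainVertex }

theorem isBiconnected_of_iso_chainBlock {V : Type*} {G : SimpleGraph V} {i : ℕ}
    (φ : G ≃g (chainBlock k i).graph) : IsBiconnected G := by
  obtain ⟨h, hb, ha⟩ := chainBlock_hamiltonian k i
  exact isBiconnected_of_hamiltonian (N := 12) (by norm_num) (φ.symm ∘ h)
    (φ.symm.bijective.comp hb) fun j => φ.symm.map_rel_iff.2 (ha j)

theorem chain_isChainOfBlocks (k : ℕ) : IsChainOfBlocks (chain k) (chainSet k) where
  biconnected i := isBiconnected_of_iso_chainBlock (chainIso k i)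
  cover_vertex v := by
    obtain ⟨i, a, rfl⟩ := exists_chainVertex v
    exact ⟨i, a, rfl⟩
  cover_edge u v h := by
    obtain ⟨i, a, b, rfl, rfl, -⟩ := chain_adj_iff.1 h
    exact ⟨i, ⟨a, rfl⟩, b, rfl⟩
  consecutive i j h := by
    refine ⟨chainVertex i 11, Set.ext fun x => ⟨?_, ?_⟩⟩
    · rintro ⟨⟨a, rfl⟩, b, hb⟩
      rw [(chainVertex_eq_of_lt (show i < j from by rw [Fin.lt_def]; omega) hb.symm).2.1]
      rfl
    · rintro rfl
      exact ⟨⟨11, rfl⟩, 0, (chainVertex_succ h.symm).symm⟩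
  nonconsecutive i j h := by
    rw [Set.disjoint_left]
    rintro _ ⟨a, rfl⟩ ⟨b, hb⟩
    have := (chainVertex_eq_of_lt (show i < j from by rw [Fin.lt_def]; omega) hb.symm).1
    omega

theorem chain_connected (k : ℕ) : (chain k).Connected := by
  have hblock : ∀ (i : Fin (k + 2)) a b,
      (chain k).Reachable (chainVertex i a) (chainVertex i b) := by
    intro i a b
    let φ : (chainBlock k i).graph →g chain k :=
      ⟨chainVertex i, fun h => chain_adj_chainVertex.2 h⟩
    have h := (isBiconnected_of_iso_chainBlock (k := k) (i := i) SimpleGraph.Iso.refl).1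
    exact (h.preconnected a b).map φ
  have hall : ∀ n (hn : n < k + 2), (chain k).Reachable (chainVertex (k := k) 0 0)
      (chainVertex ⟨n, hn⟩ 0) := by
    intro n
    induction n with
    | zero => intro hn; exact hblock 0 0 0
    | succ n ih =>
      intro hn
      refine (ih (by omega)).trans ?_
      rw [← chainVertex_succ (i := ⟨n, by omega⟩) (j := ⟨n + 1, hn⟩) rfl]
      exact hblock _ _ _
  have hroot : ∀ x, (chain k).Reachable (chainVertex (k := k) 0 0) x := by
    intro x
    obtain ⟨i, a, rfl⟩ := exists_chainVertex x
    exact (hall i i.2).trans (hblock i 0 a)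
  have : Nonempty (Fin (11 * k + 23)) := ⟨chainVertex (k := k) 0 0⟩
  exact ⟨fun u v => (hroot u).symm.trans (hroot v)⟩

theorem neighborSet_chainVertex {i : Fin (k + 2)} {a : Fin 12}
    (h : ∀ j b, chainVertex i a = chainVertex j b → i = j) :
    (chain k).neighborSet (chainVertex i a) =
      chainVertex i '' (chainBlock k i).graph.neighborSet a := by
  ext x
  constructor
  · intro hx
    obtain ⟨j, c, d, h1, rfl, hcd⟩ := chain_adj_iff.1 hx
    obtain rfl := h j c h1
    rw [chainVertex_injective _ h1]
    exact ⟨d, hcd, rfl⟩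
  · rintro ⟨b, hb, rfl⟩
    exact chain_adj_chainVertex.2 hb

/-- Two neighbors come from each of the blocks meeting there, and these pairs are disjoint. -/
theorem ncard_neighborSet_shared {i j : Fin (k + 2)} (hij : (j : ℕ) = i + 1) :
    ((chain k).neighborSet (chainVertex i 11)).ncard = 4 := by
  have hlt : i < j := by rw [Fin.lt_def]; omega
  have hN : (chain k).neighborSet (chainVertex i 11) =
      chainVertex i '' (chainBlock k i).graph.neighborSet 11 ∪
        chainVertex j '' (chainBlock k j).graph.neighborSet 0 := by
    ext x
    constructor
    · intro hx
      obtain ⟨l, c, d, h1, rfl, hcd⟩ := chain_adj_iff.1 hx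
      rcases lt_trichotomy i l with h | rfl | h
      · right
        obtain ⟨h2, -, rfl⟩ := chainVertex_eq_of_lt h h1
        obtain rfl : j = l := Fin.ext (by omega)
        exact ⟨d, hcd, rfl⟩
      · left
        rw [chainVertex_injective _ h1]
        exact ⟨d, hcd, rfl⟩
      · exact absurd (chainVertex_eq_of_lt h h1.symm).2.2 (by decide)
    · rintro (⟨b, hb, rfl⟩ | ⟨b, hb, rfl⟩)
      · exact chain_adj_chainVertex.2 hb
      · rw [SimpleGraph.mem_neighborSet, chainVertex_succ hij]
        exact chain_adj_chainVertex.2 hb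
  rw [hN, Set.ncard_union_eq, Set.ncard_image_of_injective _ (chainVertex_injective i),
    Set.ncard_image_of_injective _ (chainVertex_injective j), Block.degree_eq, Block.degree_eq,
    (chainBlock_isRightEnd (show (i : ℕ) ≠ k + 1 by omega)).degree,
    (chainBlock_isLeftEnd k (show (j : ℕ) ≠ 0 by omega)).degree]
  rw [Set.disjoint_left]
  rintro _ ⟨a, ha, rfl⟩ ⟨b, -, hb⟩
  exact (chainBlock k i).graph.ne_of_adj ha (chainVertex_eq_of_lt hlt hb.symm).2.1.symm

theorem chain_isFourRegular (k : ℕ) : IsFourRegular (chain k) := by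
  intro x
  obtain ⟨i, a, rfl⟩ := exists_chainVertex x
  by_cases h11 : a = 11 ∧ (i : ℕ) ≠ k + 1
  · obtain ⟨rfl, hi⟩ := h11
    exact ncard_neighborSet_shared (j := ⟨i + 1, by omega⟩) rfl
  by_cases h0 : a = 0 ∧ (i : ℕ) ≠ 0
  · obtain ⟨rfl, hi⟩ := h0
    have h : (i : ℕ) = ((⟨i - 1, by omega⟩ : Fin (k + 2)) : ℕ) + 1 := by simp only; omega
    rw [← chainVertex_succ h]
    exact ncard_neighborSet_shared h
  rw [neighborSet_chainVertex, Set.ncard_image_of_injective _ (chainVertex_injective i),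
    Block.degree_eq]
  · by_cases ha : a = 0
    · have hi : (i : ℕ) = 0 := by tauto
      rw [ha, chainBlock, if_pos hi, leftBlock_degree_zero]
    by_cases ha' : a = 11
    · have hi : (i : ℕ) = k + 1 := by tauto
      rw [ha', chainBlock, if_neg (by omega), if_pos hi, rightBlock_degree_last]
    exact (chainBlock_isDrawn k i).degree a ha ha'
  · intro j b h
    rcases lt_trichotomy i j with hij | hij | hij
    · have := chainVertex_eq_of_lt hij h
      exact (h11 ⟨this.2.1, by omega⟩).elim
    · exact hij
    · have := chainVertex_eq_of_lt hij h.symm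
      exact (h0 ⟨this.2.2, by omega⟩).elim

/-! ### The drawing of the chain. -/

/-- The translation applied to the `i`-th block of a chain. -/
noncomputable def chainShift (i : ℕ) : ℂ := ((i - 1 : ℕ) : ℂ) * middleBlock.pos 11

/-- A shared vertex is read as vertex 0 of the later block. The minimum concerns only the last
vertex of the chain, whose quotient by 11 would point past the last block. -/
noncomputable def chainPos (k : ℕ) (n : Fin (11 * k + 23)) : ℂ :=
  (chainBlock k (min ((n : ℕ) / 11) (k + 1))).pos ⟨n - 11 * min ((n : ℕ) / 11) (k + 1), by omega⟩ +
    chainShift (min ((n : ℕ) / 11) (k + 1))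

/-- Truncated subtraction leaves both blocks 0 and 1 unshifted: the left block ends at the origin,
where every other block starts. -/
theorem last_add_chainShift {i : ℕ} (hi : i ≠ k + 1) :
    (chainBlock k i).pos 11 + chainShift i = i * (middleBlock.pos 11 : ℂ) := by
  have hl : leftBlock.pos 11 = 0 := by decide +kernel
  unfold chainBlock chainShift
  rcases i with _ | i
  · simp [hl]
  · rw [if_neg (Nat.succ_ne_zero i), if_neg hi]; rw [Nat.add_sub_cancel]; push_cast; ring

theorem zero_add_chainShift {i : ℕ} (hi : i ≠ 0) :
    (chainBlock k i).pos 0 + chainShift i = ((i - 1 : ℕ) : ℂ) * middleBlock.pos 11 := by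
  rw [(chainBlock_isLeftEnd k hi).pos_zero, map_zero, zero_add, chainShift]

theorem chainPos_chainVertex (i : Fin (k + 2)) (a : Fin 12) :
    chainPos k (chainVertex i a) = (chainBlock k i).pos a + chainShift i := by
  have key : ∀ (m : ℕ) (j : ℕ) (hm : m < 12), j = i → m = a →
      ((chainBlock k j).pos ⟨m, hm⟩ : ℂ) + chainShift j = (chainBlock k i).pos a + chainShift i := by
    rintro m j hm rfl rfl; rfl
  have hi := i.2
  have ha := a.2
  by_cases h : (a : ℕ) = 11 ∧ (i : ℕ) ≠ k + 1
  · obtain ⟨h1, h2⟩ := h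
    have h3 : a = 11 := Fin.ext h1
    subst h3
    rw [last_add_chainShift h2]
    have h4 : min ((chainVertex i 11 : ℕ) / 11) (k + 1) = i + 1 := by
      simp only [chainVertex]; omega
    have h5 : (⟨(chainVertex i 11 : ℕ) - 11 * min ((chainVertex i 11 : ℕ) / 11) (k + 1),
        by omega⟩ : Fin 12) = 0 := by
      refine Fin.ext ?_
      simp only [h4]
      simp only [chainVertex]
      change _ = 0
      omega
    rw [chainPos, h5, h4, zero_add_chainShift (by omega)]
    simp
  · refine key _ _ _ ?_ ?_
    · simp only [chainVertex]; omega
    · simp only [chainVertex]; omega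

theorem middleBlock_width : 0 < ((middleBlock.pos 11 : GaussianInt) : ℂ).re := by
  rw [← GaussianInt.intCast_re]
  exact_mod_cast (by decide +kernel : 0 < (middleBlock.pos 11).re)

theorem re_last_le {i j : Fin (k + 2)} (hij : i < j) :
    (((chainBlock k i).pos 11 : ℂ) + chainShift i).re ≤
      (((chainBlock k j).pos 0 : ℂ) + chainShift j).re ∧
    ((((chainBlock k i).pos 11 : ℂ) + chainShift i).re =
      (((chainBlock k j).pos 0 : ℂ) + chainShift j).re → (j : ℕ) = i + 1) := by
  have hij : (i : ℕ) < j := hij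
  have hj := j.2
  rw [last_add_chainShift (by omega), zero_add_chainShift (by omega), ← ofReal_natCast,
    ← ofReal_natCast, re_ofReal_mul, re_ofReal_mul]
  have hw := middleBlock_width
  refine ⟨mul_le_mul_of_nonneg_right (by exact_mod_cast (by omega : (i : ℕ) ≤ j - 1)) hw.le, ?_⟩
  intro h
  have h : (i : ℕ) = j - 1 := by exact_mod_cast mul_right_cancel₀ hw.ne' h
  omega

theorem valC_fst (z : ℂ) : Piece.valC (1, 0) z = z.re := by simp [Piece.valC]

theorem valC_neg_fst (z : ℂ) : Piece.valC (-1, 0) z = -z.re := by simp [Piece.valC]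

/-- The curve of an edge of a chain. -/
noncomputable def chainCurve (i : Fin (k + 2)) (e : EdgeCode) : Set ℂ :=
  e.curve (chainPos k (chainVertex i e.src))

theorem mem_chainCurve {i : Fin (k + 2)} {e : EdgeCode} {z : ℂ} :
    z ∈ chainCurve i e ↔ z - chainShift i ∈ e.curve ((chainBlock k i).pos e.src) := by
  rw [chainCurve, chainPos_chainVertex, EdgeCode.mem_curve_add]

/-- Block `i` lies weakly left of its vertex 11, and block `j` weakly right of its vertex 0. A
common point forces these vertices onto one vertical line, so the blocks are consecutive and the
point is their shared vertex. -/
theorem chainCurve_inter_of_lt {i j : Fin (k + 2)} (hij : i < j) {e f : EdgeCode}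
    (he : e ∈ (chainBlock k i).edges) (hf : f ∈ (chainBlock k j).edges) {z : ℂ}
    (hz : z ∈ chainCurve i e) (hz' : z ∈ chainCurve j f) :
    ∃ w, w ∈ s(chainVertex i e.src, chainVertex i e.tgt) ∧
      w ∈ s(chainVertex j f.src, chainVertex j f.tgt) ∧ z = chainPos k w := by
  rw [mem_chainCurve] at hz hz'
  have hlt : (i : ℕ) < j := hij
  have hj := j.2
  have h1 := ((chainBlock_isRightEnd (show (i : ℕ) ≠ k + 1 by omega)).below e he).valC_lt_or
    ((chainBlock_isDrawn k i).valid e he).1 hz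
  have h2 := ((chainBlock_isLeftEnd k (show (j : ℕ) ≠ 0 by omega)).below f hf).valC_lt_or
    ((chainBlock_isDrawn k j).valid f hf).1 hz'
  rw [valC_fst, valC_fst] at h1
  rw [valC_neg_fst, valC_neg_fst] at h2
  obtain ⟨h3, h4⟩ := re_last_le hij
  simp only [sub_re, add_re] at h1 h2 h3 h4
  have e1 : (z - chainShift i).re ≤ (((chainBlock k i).pos 11 : GaussianInt) : ℂ).re := by
    rcases h1 with h1 | ⟨-, h1⟩
    · exact h1.le
    · rw [h1]
  have e2 : (((chainBlock k j).pos 0 : GaussianInt) : ℂ).re ≤ (z - chainShift j).re := by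
    rcases h2 with h2 | ⟨-, h2⟩
    · rw [sub_re]; linarith
    · rw [h2]
  rw [sub_re] at e1 e2
  have h5 := h4 (by linarith)
  have g1 : 11 ∈ s(e.src, e.tgt) ∧ z - chainShift i = (chainBlock k i).pos 11 := by
    rcases h1 with h1 | h1
    · linarith
    · exact h1
  have g2 : 0 ∈ s(f.src, f.tgt) := by
    rcases h2 with h2 | h2
    · linarith
    · exact h2.1
  refine ⟨chainVertex i 11, ?_, ?_, ?_⟩
  · rw [← Sym2.map_mk]; exact Sym2.mem_map.2 ⟨_, g1.1, rfl⟩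
  · rw [chainVertex_succ h5, ← Sym2.map_mk]; exact Sym2.mem_map.2 ⟨_, g2, rfl⟩
  · rw [chainPos_chainVertex, ← g1.2]; ring

theorem chainPos_injective (k : ℕ) : Function.Injective (chainPos k) := by
  have hlt : ∀ (i j : Fin (k + 2)) a b, i < j →
      chainPos k (chainVertex i a) = chainPos k (chainVertex j b) →
      chainVertex i a = chainVertex j b := by
    intro i j a b hij h
    have hlt : (i : ℕ) < j := hij
    have hj := j.2
    rw [chainPos_chainVertex, chainPos_chainVertex] at h
    obtain ⟨h3, h4⟩ := re_last_le hij
    have hre := congrArg Complex.re h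
    have h1 : a = 11 ∨ (((chainBlock k i).pos a : GaussianInt) : ℂ).re <
        (((chainBlock k i).pos 11 : GaussianInt) : ℂ).re := by
      rw [← GaussianInt.intCast_re, ← GaussianInt.intCast_re, or_iff_not_imp_left]
      intro ha
      exact_mod_cast (chainBlock_isRightEnd (show (i : ℕ) ≠ k + 1 by omega)).re_lt a ha
    have h2 : b = 0 ∨ (((chainBlock k j).pos 0 : GaussianInt) : ℂ).re <
        (((chainBlock k j).pos b : GaussianInt) : ℂ).re := by
      rw [← GaussianInt.intCast_re, ← GaussianInt.intCast_re, or_iff_not_imp_left]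
      intro hb
      exact_mod_cast (chainBlock_isLeftEnd k (show (j : ℕ) ≠ 0 by omega)).re_lt b hb
    simp only [add_re] at hre h3 h4
    rcases h1 with rfl | h1 <;> rcases h2 with rfl | h2
    · exact chainVertex_succ (h4 hre)
    · linarith
    · linarith
    · linarith
  intro x y h
  obtain ⟨i, a, rfl⟩ := exists_chainVertex x
  obtain ⟨j, b, rfl⟩ := exists_chainVertex y
  rcases lt_trichotomy i j with hij | rfl | hij
  · exact hlt i j a b hij h
  · rw [chainPos_chainVertex, chainPos_chainVertex] at h
    rw [(chainBlock_isDrawn k i).pos_injective (GaussianInt.toComplex_injective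
      (add_right_cancel h))]
  · exact (hlt j i b a hij h.symm).symm

/-- The edge `e` of the `i`-th block uses the port `x` at the vertex `w`. -/
def UsesPort (i : Fin (k + 2)) (e : EdgeCode) (w : Fin (11 * k + 23)) (x : ℂ) : Prop :=
  (chainVertex i e.src = w ∧ (e.srcPort : ℂ) = x) ∨ (chainVertex i e.tgt = w ∧ (e.tgtPort : ℂ) = x)

theorem usesPort_iff {i : Fin (k + 2)} {e : EdgeCode} {w : Fin (11 * k + 23)} {x : ℂ} :
    UsesPort i e w x ↔ ∃ y ∈ e.ports, chainVertex i y.1 = w ∧ (y.2 : ℂ) = x := by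
  simp [UsesPort, EdgeCode.ports]

/-- At a shared vertex the earlier block uses the left and upper ports, the later one the right and
lower ports. -/
theorem not_usesPort_of_lt {i j : Fin (k + 2)} (hij : i < j) {e f : EdgeCode}
    (he : e ∈ (chainBlock k i).edges) (hf : f ∈ (chainBlock k j).edges) {w : Fin (11 * k + 23)}
    {x : ℂ} (h1 : UsesPort i e w x) (h2 : UsesPort j f w x) : False := by
  obtain ⟨y, hy, rfl, rfl⟩ := usesPort_iff.1 h1
  obtain ⟨y', hy', hv, hx⟩ := usesPort_iff.1 h2
  have hlt : (i : ℕ) < j := hij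
  have hj := j.2
  obtain ⟨-, ha, hb⟩ := chainVertex_eq_of_lt hij hv.symm
  have p1 := (chainBlock_isRightEnd (show (i : ℕ) ≠ k + 1 by omega)).ports e he y hy ha
  have p2 := (chainBlock_isLeftEnd k (show (j : ℕ) ≠ 0 by omega)).ports f hf y' hy' hb
  rw [GaussianInt.toComplex_injective hx] at p2
  have : ∀ p ∈ [-1, gaussI], p ∉ [1, -gaussI] := by decide
  exact this _ p1 p2

theorem chain_admitsBendlessSmoothOrthogonal (k : ℕ) :
    AdmitsBendlessSmoothOrthogonal (chain k) := by
  let ι := {x : Fin (k + 2) × EdgeCode // x.2 ∈ (chainBlock k x.1).edges}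
  refine admitsBendlessSmoothOrthogonal_of_family (ι := ι) (chainPos k) (chainPos_injective k)
    (fun e => chainVertex e.1.1 e.1.2.src) (fun e => chainVertex e.1.1 e.1.2.tgt)
    (fun e => chainCurve e.1.1 e.1.2) (fun e => e.1.2.srcPort) (fun e => e.1.2.tgtPort)
    ?_ ?_ ?_ ?_ ?_ ?_
  · rintro u v ⟨-, i, e, he, h⟩
    exact ⟨⟨(i, e), he⟩, h⟩
  · rintro ⟨⟨i, e⟩, he⟩
    obtain ⟨h1, h2, -⟩ := (chainBlock_isDrawn k i).valid e he
    have h3 : chainPos k (chainVertex i e.tgt) = chainPos k (chainVertex i e.src) + e.disp := by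
      rw [chainPos_chainVertex, chainPos_chainVertex, h2, map_add]; ring
    simp only [h3]
    exact h1.isSmoothEdge _
  · rintro ⟨⟨i, e⟩, he⟩ ⟨⟨j, f⟩, hf⟩ hne z ⟨hz, hz'⟩
    simp only at he hf hz hz' ⊢
    rcases lt_trichotomy i j with hij | rfl | hij
    · exact chainCurve_inter_of_lt hij he hf hz hz'
    · have hef : e ≠ f := fun h => hne (by subst h; rfl)
      rw [mem_chainCurve] at hz hz'
      obtain ⟨w, h1, h2, h3⟩ := ((chainBlock_isDrawn k i).rel he hf hef).1 _ hz hz'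
      refine ⟨chainVertex i w, ?_, ?_, ?_⟩
      · rw [← Sym2.map_mk]; exact Sym2.mem_map.2 ⟨_, h1, rfl⟩
      · rw [← Sym2.map_mk]; exact Sym2.mem_map.2 ⟨_, h2, rfl⟩
      · rw [chainPos_chainVertex, ← h3]; ring
    · obtain ⟨w, h1, h2, h3⟩ := chainCurve_inter_of_lt hij hf he hz' hz
      exact ⟨w, h2, h1, h3⟩
  · rintro ⟨⟨i, e⟩, he⟩ ⟨⟨j, f⟩, hf⟩ h
    simp only at he hf h
    have hst := ((chainBlock_isDrawn k i).valid e he).2.2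
    obtain rfl : i = j := by
      rcases Sym2.eq_iff.1 h with ⟨h1, h2⟩ | ⟨h1, h2⟩
      · exact block_eq_of_shared hst h1 h2
      · exact block_eq_of_shared hst h1 h2
    have h' : s(e.src, e.tgt) = s(f.src, f.tgt) := by
      rw [← Sym2.map_mk, ← Sym2.map_mk] at h
      exact Sym2.map.injective (chainVertex_injective i) h
    by_contra hne
    exact ((chainBlock_isDrawn k i).rel he hf (fun h => hne (by subst h; rfl))).2.1 h'
  · rintro ⟨⟨i, e⟩, he⟩ ⟨⟨j, f⟩, hf⟩ w x h1 h2
    change UsesPort i e w x at h1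
    change UsesPort j f w x at h2
    simp only at he hf
    rcases lt_trichotomy i j with hij | rfl | hij
    · exact (not_usesPort_of_lt hij he hf h1 h2).elim
    · by_contra hne
      obtain ⟨y, hy, rfl, rfl⟩ := usesPort_iff.1 h1
      obtain ⟨y', hy', hv, hx⟩ := usesPort_iff.1 h2
      have hyy : y' = y :=
        Prod.ext (chainVertex_injective i hv) (GaussianInt.toComplex_injective hx)
      subst hyy
      exact ((chainBlock_isDrawn k i).rel he hf (fun h => hne (by subst h; rfl))).2.2 _ hy hy'
    · exact (not_usesPort_of_lt hij hf he h2 h1).elim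
  · intro v
    have h : ((chain k).neighborSet v).ncard ≠ 0 := by rw [chain_isFourRegular k v]; norm_num
    exact Set.nonempty_of_ncard_ne_zero h

end

/-! ### The end gadget and the conclusion. -/

theorem AdmitsBendlessSmoothOrthogonal.isPlanarGraph {V : Type*} {G : SimpleGraph V}
    (h : AdmitsBendlessSmoothOrthogonal G) : IsPlanarGraph G :=
  h.nonempty

/-- The labels 4 and 5 are exchanged, because in the block the antipodes of 0 and 1 are 5 and 4. -/
theorem leftBlock_punctured : ∀ e ∈ punctured,
    leftBlock.graph.Adj (![0, 1, 2, 3, 5, 4] e.1) (![0, 1, 2, 3, 5, 4] e.2) := by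
  decide +kernel

theorem leftBlock_admitsBendlessSmoothOrthogonal :
    AdmitsBendlessSmoothOrthogonal leftBlock.graph :=
  (chain_admitsBendlessSmoothOrthogonal 0).comap (chainVertex 0) (chainVertex_injective 0)
    fun _ _ h => chain_adj_chainVertex.2 h

theorem leftBlock_isEndGadget : IsEndGadget leftBlock.graph where
  finite := inferInstance
  biconnected := isBiconnected_of_iso_chainBlock (k := 0) (i := 0) SimpleGraph.Iso.refl
  planar := leftBlock_admitsBendlessSmoothOrthogonal.isPlanarGraph
  degree := by
    refine ⟨11, ?_, fun w hw => ?_⟩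
    · rw [Block.degree_eq, leftBlock_isRightEnd.degree]
    · rw [Block.degree_eq]
      by_cases h : w = 0
      · rw [h, leftBlock_degree_zero]
      · exact leftBlock_isDrawn.degree w h hw

theorem chainBlock_last (k : ℕ) : chainBlock k (Fin.last (k + 1)) = rightBlock := by
  simp [chainBlock]

theorem theorem2 :
    ∃ (W : Type) (C : SimpleGraph W) (V : ℕ → Type) (G : ∀ k, SimpleGraph (V k)),
      -- the fixed gadget
      IsEndGadget C ∧ AdmitsBendlessSmoothOrthogonal C ∧ ¬ AdmitsBendlessOctilinear C ∧
      -- the family is infinite: its members are pairwise non-isomorphic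
      (∀ i j, Nonempty (G i ≃g G j) → i = j) ∧
      ∀ k,
        Finite (V k) ∧ (G k).Connected ∧ IsFourRegular (G k) ∧ IsPlanarGraph (G k) ∧
        -- a chain of `k + 2` biconnected components whose end-components are copies of `C`
        (∃ B : Fin (k + 2) → Set (V k), IsChainOfBlocks (G k) B ∧
          Nonempty ((G k).induce (B 0) ≃g C) ∧
          Nonempty ((G k).induce (B (Fin.last (k + 1))) ≃g C)) ∧
        AdmitsBendlessSmoothOrthogonal (G k) ∧
        ¬ AdmitsBendlessOctilinear (G k) := by
  have hinj : Function.Injective (![0, 1, 2, 3, 5, 4] : Fin 6 → Fin 12) := by decide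
  refine ⟨Fin 12, leftBlock.graph, fun k => Fin (11 * k + 23), chain, leftBlock_isEndGadget,
    leftBlock_admitsBendlessSmoothOrthogonal,
    not_admitsBendlessOctilinear_of_punctured _ hinj leftBlock_punctured, ?_, fun k => ?_⟩
  · rintro i j ⟨φ⟩
    have := Fintype.card_congr φ.toEquiv
    simp only [Fintype.card_fin] at this
    omega
  · have hs := chain_admitsBendlessSmoothOrthogonal k
    refine ⟨inferInstance, chain_connected k, chain_isFourRegular k, hs.isPlanarGraph,
      ⟨chainSet k, chain_isChainOfBlocks k, ⟨chainIso k 0⟩, ?_⟩, hs, ?_⟩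
    · have φ := chainIso k (Fin.last (k + 1))
      rw [chainBlock_last] at φ
      exact ⟨φ.trans rightBlockIso⟩
    · exact not_admitsBendlessOctilinear_of_punctured (chainVertex 0 ∘ ![0, 1, 2, 3, 5, 4])
        ((chainVertex_injective 0).comp hinj)
        fun e he => chain_adj_chainVertex.2 (leftBlock_punctured e he)

end
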